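/- Let $\mathcal K$ be a field, let $<$ be an admissible monomial order on $\mathcal K[x_1,\dots,x_n]$, and let $f_1,\dots,f_m$ ($m\ge 1$) be nonzero homogeneous polynomials. Write $\mathrm{HM}(p)$ for the head monomial and $\mathrm{HC}(p)$ for the head coefficient of a polynomial $p\neq 0$. A signature is a symbol $tF_k$ with a monomial $t$ and an index $k\in\{1,\dots,m\}$; signatures are ordered by $tF_k\prec t'F_{k'}$ iff $k>k'$, or $k=k'$ and $t<t'$. A labeled polynomial $r=(\mathcal S(r),\mathrm{poly}(r))$ consists of a signature and a polynomial; $\mathrm{HM}(r)=\mathrm{HM}(\mathrm{poly}(r))$. Consider Faugère's F5 algorithm on the input $f_1,\dots,f_m$: * incrementalF5. There are a table of labeled polynomials $r_1,r_2,\dots$, a counter $N:=m$, and for each index $k$ a list $Rule[k]$, initially empty. Put $r_m:=(1F_m,f_m/\mathrm{HC}(f_m))$, $G_m:=\{r_m\}$. For $i=m-1,\dots,1$ compute $G_i:=\texttt{AlgorithmF5}(i,f_i,G_{i+1})$; if $1\in\mathrm{poly}(G_i)$, return $\{1\}$. Finally return $\mathrm{poly}(G_1)$. * AlgorithmF5$(i,f_i,G_{i+1})$.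 Let $r_i:=(1F_i,f_i/\mathrm{HC}(f_i))$, let $\varphi$ be the normal form (complete reduction) modulo $\mathrm{poly}(G_{i+1})$, let $G_i:=G_{i+1}\cup\{r_i\}$, and let $P$ be the set of the pairs returned by $\texttt{CritPair}(r_i,r)$, $r\in G_{i+1}$. **While** $P\neq\emptyset$: let $d$ be the smallest degree of a pair in $P$, remove the set $P_d$ of all pairs of degree $d$ from $P$, let $F:=\texttt{Spol}(P_d)$ and $R_d:=\texttt{Reduction}(F,G_i)$; **for** each $r\in R_d$, add to $P$ the pairs returned by $\texttt{CritPair}(r,r')$ for all $r'\in G_i$, and then add $r$ to $G_i$. When $P=\emptyset$, return $G_i$. * CritPair$(r,r')$. Let $t=\mathrm{lcm}(\mathrm{HM}(r),\mathrm{HM}(r'))$, $u=t/\mathrm{HM}(r)$, $v=t/\mathrm{HM}(r')$; exchange the two parts if $u\mathcal S(r)\prec v\mathcal S(r')$. With $\mathcal S(r)=sF_k$, $\mathcal S(r')=s'F_{k'}$, return nothing if $k>i$, or $\varphi(us)\ne us$, or $k'=i$ and $\varphi(vs')\neq vs'$; otherwise return the critical pair $[t,u,r,v,r']$, whose degree is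 $\deg t$. * Rewritten?$(u,r_k)$. With $\mathcal S(r_k)=sF_l$, this is true iff some rule in $Rule[l]$ has a monomial dividing $us$ and the newest such rule belongs to a labeled polynomial other than $r_k$. Add Rule$(r_N)$, for $\mathcal S(r_N)=tF_l$, puts $(t,N)$ as newest rule into $Rule[l]$. * Spol$(P_d)$. Start with $F=\emptyset$. For each $[t,u,r,v,r']\in P_d$, unless Rewritten?$(u,r)$ or Rewritten?$(v,r')$, increase $N$ by one, put $r_N:=(u\mathcal S(r),\,u\,\mathrm{poly}(r)-v\,\mathrm{poly}(r'))$, add its rule, and add $r_N$ to $F$. Return $F$. * Reduction$(F,G_i)$. Start with $ToDo:=F$, $Done:=\emptyset$. **While** $ToDo\ne\emptyset$: take $h\in ToDo$ of smallest signature and replace $\mathrm{poly}(h)$ by $q:=\varphi(\mathrm{poly}(h))$. If $q=0$, remove $h$ from $ToDo$. Otherwise look for a reductor (IsReducible): some $r\in G_i\cup Done$ such that (a) $\mathrm{HM}(r)\mid\mathrm{HM}(q)$, and with $u=\mathrm{HM}(q)/\mathrm{HM}(r)$, $\mathcal S(r)=sF_k$, (b) $\varphi(us)=us$, (c) not Rewritten?$(u,r)$,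 (d) $u\mathcal S(r)\neq\mathcal S(h)$. If there is none, make $\mathrm{poly}(h)$ monic and move $h$ from $ToDo$ to $Done$. If a reductor $r$ is found and $u\mathcal S(r)\prec\mathcal S(h)$, replace $\mathrm{poly}(h)$ by $q-\mathrm{HC}(q)\,u\,\mathrm{poly}(r)$ and leave $h$ in $ToDo$. If a reductor is found and $u\mathcal S(r)\not\prec\mathcal S(h)$, leave $h$ in $ToDo$, increase $N$ by one, put $r_N:=(u\mathcal S(r),\,\mathrm{HC}(q)\,u\,\mathrm{poly}(r)-q)$, add its rule, and add $r_N$ to $ToDo$. When $ToDo=\emptyset$, return $R_d:=Done$. Sets may be traversed in any order, ties may be broken in any way, any reductor satisfying (a)–(d) may be chosen, and $\varphi$ may return any normal form. Then for every execution: 1. Every iteration of the **while** cycle inside AlgorithmF5 that is started ends after finitely many steps; in particular every call to Reduction returns after finitely many steps. 2. Within one call to AlgorithmF5, let $d_j$ be the value of $d$ in the $j$-th iteration of the **while** cycle. Then $d_{j+2}>d_j$ whenever the $(j+2)$-nd iteration takes place. 3. Hence, if the execution does not terminate, then it contains a call to AlgorithmF5 whose **while** cycle, from the first iteration of that call on,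 is executed infinitely often (and no other call follows it), and in this call $d_{j+2}>d_j$ for all $j$ and $d_j\to\infty$. -/

import Mathlib

open MvPolynomial

namespace F5

/-- A signature `t • F_k`: a monomial `t` (given by its exponent vector) and an index `k`. -/
structure Sig (n : ℕ) where
  mon : Fin n →₀ ℕ
  idx : ℕ

/-- The product of a monomial and a signature. -/
noncomputable def Sig.mul {n : ℕ} (u : Fin n →₀ ℕ) (S : Sig n) : Sig n := ⟨u + S.mon, S.idx⟩

/-- The order on signatures: `F_1 ≻ F_2 ≻ ⋯ ≻ F_m`, and for equal indices the monomials are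
compared by the monomial order that is used for the polynomials. -/
def Sig.lt {n : ℕ} (o : MonomialOrder (Fin n)) (S T : Sig n) : Prop :=
  T.idx < S.idx ∨ (S.idx = T.idx ∧ o.toSyn S.mon < o.toSyn T.mon)

/-- A labeled polynomial. -/
structure LabPoly (n : ℕ) (K : Type*) [Field K] where
  sig : Sig n
  poly : MvPolynomial (Fin n) K

/-- A critical pair `[t, u₁, r_{k₁}, u₂, r_{k₂}]`; labeled polynomials are referred to by their
position in the table `R`. -/
structure CritPair (n : ℕ) where
  t : Fin n →₀ ℕ
  u₁ : Fin n →₀ ℕ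
  k₁ : ℕ
  u₂ : Fin n →₀ ℕ
  k₂ : ℕ
deriving DecidableEq

/-- The degree of a critical pair is the total degree of the monomial `t`. -/
noncomputable def CritPair.deg {n : ℕ} (p : CritPair n) : ℕ := p.t.degree

/-- One step of the reduction of `p` modulo `B`: a monomial `c` of `p` that is divisible by the
head monomial of some nonzero `b ∈ B` is eliminated. -/
def RedStep {n : ℕ} {K : Type*} [Field K] (o : MonomialOrder (Fin n))
    (B : Set (MvPolynomial (Fin n) K)) (p q : MvPolynomial (Fin n) K) : Prop :=
  ∃ b ∈ B, b ≠ 0 ∧ ∃ c ∈ p.support, o.degree b ≤ c ∧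
    q = p - monomial (c - o.degree b) (p.coeff c / o.leadingCoeff b) * b

/-- `q` is a normal form of `p` modulo `B`. -/
def IsNormalForm {n : ℕ} {K : Type*} [Field K] (o : MonomialOrder (Fin n))
    (B : Set (MvPolynomial (Fin n) K)) (p q : MvPolynomial (Fin n) K) : Prop :=
  Relation.ReflTransGen (RedStep o B) p q ∧ ∀ q', ¬ RedStep o B q q'

/-- The test `φ(t) = t` for a monomial `t`, where `φ` is the normal form modulo `B`. -/
def FixedMon {n : ℕ} {K : Type*} [Field K] (o : MonomialOrder (Fin n))
    (B : Set (MvPolynomial (Fin n) K)) (t : Fin n →₀ ℕ) : Prop :=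
  IsNormalForm o B (monomial t 1) (monomial t 1)

/-- The global variables: the table `R` of labeled polynomials, the position `N` of the last
labeled polynomial of the table, and for each index the list of its rules, newest first. A rule is a
monomial together with the position of a labeled polynomial. -/
structure Store (n : ℕ) (K : Type*) [Field K] where
  R : ℕ → LabPoly n K
  N : ℕ
  Rule : ℕ → List ((Fin n →₀ ℕ) × ℕ)

namespace Store

variable {n : ℕ} {K : Type*} [Field K]

def sig (s : Store n K) (k : ℕ) : Sig n := (s.R k).sig

def poly (s : Store n K) (k : ℕ) : MvPolynomial (Fin n) K := (s.R k).poly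

/-- The head monomial of `r_k`. -/
noncomputable def hm (o : MonomialOrder (Fin n)) (s : Store n K) (k : ℕ) : Fin n →₀ ℕ :=
  o.degree (s.poly k)

/-- Change the polynomial part of `r_k`. -/
def setPoly (s : Store n K) (k : ℕ) (p : MvPolynomial (Fin n) K) : Store n K :=
  { s with R := Function.update s.R k ⟨s.sig k, p⟩ }

/-- Enter the input polynomial `g`, made monic, as `r_i = (F_i, g)`. -/
noncomputable def setInput (o : MonomialOrder (Fin n)) (s : Store n K) (i : ℕ)
    (g : MvPolynomial (Fin n) K) : Store n K :=
  { s with R := Function.update s.R i ⟨⟨0, i⟩, C (o.leadingCoeff g)⁻¹ * g⟩ }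

/-- `N := N + 1`, `r_N := (S, p)`, followed by `Add Rule(r_N)`. -/
def push (s : Store n K) (S : Sig n) (p : MvPolynomial (Fin n) K) : Store n K where
  R := Function.update s.R (s.N + 1) ⟨S, p⟩
  N := s.N + 1
  Rule := Function.update s.Rule S.idx ((S.mon, s.N + 1) :: s.Rule S.idx)

open Classical in
/-- The procedure `Rewrite(u, r_k)`: look for the newest rule whose monomial divides the monomial
of the signature of `u r_k`. -/
noncomputable def rewrite (s : Store n K) (u : Fin n →₀ ℕ) (k : ℕ) : (Fin n →₀ ℕ) × ℕ :=
  match (s.Rule (s.sig k).idx).find? (fun ρ => decide (ρ.1 ≤ u + (s.sig k).mon)) with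
  | some ρ => (u + (s.sig k).mon - ρ.1, ρ.2)
  | none => (u, k)

/-- The test `Rewritten?(u, r_k)`. -/
def Rewritten (s : Store n K) (u : Fin n →₀ ℕ) (k : ℕ) : Prop := (s.rewrite u k).2 ≠ k

open Classical in
/-- The part of `CritPair` that is executed once the generators are ordered in such a way that the
first part of the pair has the greater signature. -/
noncomputable def critPairOrdered (o : MonomialOrder (Fin n)) (s : Store n K) (i : ℕ)
    (B : Set (MvPolynomial (Fin n) K)) (k l : ℕ) : Finset (CritPair n) :=
  let t := s.hm o k ⊔ s.hm o l
  let u := t - s.hm o k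
  let v := t - s.hm o l
  if i < (s.sig k).idx ∨ ¬ FixedMon o B (u + (s.sig k).mon) ∨
      ((s.sig l).idx = i ∧ ¬ FixedMon o B (v + (s.sig l).mon))
  then ∅
  else {⟨t, u, k, v, l⟩}

open Classical in
/-- The procedure `CritPair(r_k, r_l, i, φ)`, where `φ` is the normal form modulo `B`. -/
noncomputable def critPair (o : MonomialOrder (Fin n)) (s : Store n K) (i : ℕ)
    (B : Set (MvPolynomial (Fin n) K)) (k l : ℕ) : Finset (CritPair n) :=
  let t := s.hm o k ⊔ s.hm o l
  if Sig.lt o ((s.sig k).mul (t - s.hm o k)) ((s.sig l).mul (t - s.hm o l))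
  then s.critPairOrdered o i B l k
  else s.critPairOrdered o i B k l

/-- `r_j` is one of the labeled polynomials of `G` that `IsReducible` may return as a reductor of
`r_h`, whose polynomial part is `q`: the conditions are (a), (b), (c), (d) in this order. -/
def IsReductor (o : MonomialOrder (Fin n)) (s : Store n K) (B : Set (MvPolynomial (Fin n) K))
    (G : Finset ℕ) (h : ℕ) (q : MvPolynomial (Fin n) K) (j : ℕ) : Prop :=
  j ∈ G ∧ s.hm o j ≤ o.degree q ∧
    FixedMon o B (o.degree q - s.hm o j + (s.sig j).mon) ∧
    ¬ s.Rewritten (o.degree q - s.hm o j) j ∧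
    (s.sig j).mul (o.degree q - s.hm o j) ≠ s.sig h

end Store

/-- The local variables of a call `AlgorithmF5(i, f_i, G_{i+1})`: the index `i`, the set
`base = poly(G_{i+1})` that defines the normal form `φ_{i+1}`, the set `G = G_i` and the set `P` of
critical pairs. -/
structure Frame (n : ℕ) (K : Type*) [Field K] where
  i : ℕ
  base : Set (MvPolynomial (Fin n) K)
  G : Finset ℕ
  P : Finset (CritPair n)

/-- The states of the execution.
* `outer s i G`: in `incrementalF5`, the set `G_i = G` has just been computed;
* `head s A`: in `AlgorithmF5`, at the test of the **while** cycle;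
* `spol s A d Pd F`: inside `Spol`, `Pd` is the set of pairs that are still to be treated;
* `red s A d ToDo Done`: inside `Reduction`, at the test of its **while** cycle;
* `ins s A d Rd`: in `AlgorithmF5`, inside the **for** cycle over `R_d`, where `Rd` is the set of
  elements that are still to be treated;
* `halted out`: the algorithm has returned `out`. -/
inductive State (n : ℕ) (K : Type*) [Field K] where
  | outer (s : Store n K) (i : ℕ) (G : Finset ℕ)
  | head (s : Store n K) (A : Frame n K)
  | spol (s : Store n K) (A : Frame n K) (d : ℕ) (Pd : Finset (CritPair n)) (F : Finset ℕ)
  | red (s : Store n K) (A : Frame n K) (d : ℕ) (ToDo Done : Finset ℕ)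
  | ins (s : Store n K) (A : Frame n K) (d : ℕ) (Rd : Finset ℕ)
  | halted (out : Set (MvPolynomial (Fin n) K))

section Semantics

variable {n : ℕ} {K : Type*} [Field K]

/-- `d = deg(first(P))` for `P` sorted by degree; in particular `P` is nonempty. -/
def IsFirstDegree (P : Finset (CritPair n)) (d : ℕ) : Prop :=
  (∃ p ∈ P, p.deg = d) ∧ ∀ p ∈ P, d ≤ p.deg

/-- The store and the frame with which the call `AlgorithmF5(i, g, G)` arrives at its **while**
cycle. -/
noncomputable def enter (o : MonomialOrder (Fin n)) (s : Store n K) (i : ℕ)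
    (g : MvPolynomial (Fin n) K) (G : Finset ℕ) : State n K :=
  let s' := s.setInput o i g
  let B := s'.poly '' (G : Set ℕ)
  .head s' ⟨i, B, insert i G, G.biUnion (fun k => s'.critPair o i B i k)⟩

/-- One step of the execution of F5 on the input `f 1, …, f m`. Sets may be traversed in any order,
ties may be broken in any way, `IsReducible` may return any admissible reductor, and `φ` may return
any normal form. -/
inductive Step (o : MonomialOrder (Fin n)) (f : ℕ → MvPolynomial (Fin n) K) :
    State n K → State n K → Prop
  /-- `incrementalF5` calls `AlgorithmF5` for the next index -/
  | call (s : Store n K) (i : ℕ) (G : Finset ℕ) (hi : 1 ≤ i) :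
      Step o f (.outer s (i + 1) G) (enter o s i (f i) G)
  /-- `incrementalF5` has treated all input polynomials -/
  | finish (s : Store n K) (i : ℕ) (G : Finset ℕ) (hi : i ≤ 1) :
      Step o f (.outer s i G) (.halted (s.poly '' (G : Set ℕ)))
  /-- `AlgorithmF5` returns `G_i` -/
  | ret (s : Store n K) (A : Frame n K) (hP : A.P = ∅) (h1 : ∀ k ∈ A.G, s.poly k ≠ 1) :
      Step o f (.head s A) (.outer s A.i A.G)
  /-- `AlgorithmF5` returns `G_i` containing `1`, which makes `incrementalF5` return `{1}` -/
  | retOne (s : Store n K) (A : Frame n K) (hP : A.P = ∅) (h1 : ∃ k ∈ A.G, s.poly k = 1) :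
      Step o f (.head s A) (.halted {1})
  /-- a new iteration starts: `d := deg(first(P))`, the pairs of degree `d` go to `Spol` -/
  | iter (s : Store n K) (A : Frame n K) (d : ℕ) (hd : IsFirstDegree A.P d) :
      Step o f (.head s A)
        (.spol s { A with P := A.P.filter (fun p => p.deg ≠ d) } d
          (A.P.filter (fun p => p.deg = d)) ∅)
  /-- `Spol` discards a pair -/
  | spolSkip (s : Store n K) (A : Frame n K) (d : ℕ) (Pd : Finset (CritPair n)) (F : Finset ℕ)
      (p : CritPair n) (hp : p ∈ Pd) (hr : s.Rewritten p.u₁ p.k₁ ∨ s.Rewritten p.u₂ p.k₂) :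
      Step o f (.spol s A d Pd F) (.spol s A d (Pd.erase p) F)
  /-- `Spol` computes an S-polynomial -/
  | spolAdd (s : Store n K) (A : Frame n K) (d : ℕ) (Pd : Finset (CritPair n)) (F : Finset ℕ)
      (p : CritPair n) (hp : p ∈ Pd) (hr : ¬ s.Rewritten p.u₁ p.k₁ ∧ ¬ s.Rewritten p.u₂ p.k₂) :
      Step o f (.spol s A d Pd F)
        (.spol
          (s.push ((s.sig p.k₁).mul p.u₁)
            (monomial p.u₁ 1 * s.poly p.k₁ - monomial p.u₂ 1 * s.poly p.k₂))
          A d (Pd.erase p) (insert (s.N + 1) F))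
  /-- `Spol` returns `F`, and `Reduction` is called -/
  | spolRet (s : Store n K) (A : Frame n K) (d : ℕ) (F : Finset ℕ) :
      Step o f (.spol s A d ∅ F) (.red s A d F ∅)
  /-- `TopReduction` of `φ(r_h) = 0` -/
  | redZero (s : Store n K) (A : Frame n K) (d : ℕ) (ToDo Done : Finset ℕ) (h : ℕ)
      (hh : h ∈ ToDo) (hmin : ∀ k ∈ ToDo, ¬ Sig.lt o (s.sig k) (s.sig h))
      (hq : IsNormalForm o A.base (s.poly h) 0) :
      Step o f (.red s A d ToDo Done) (.red (s.setPoly h 0) A d (ToDo.erase h) Done)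
  /-- `TopReduction` finds no reductor: `r_h` is made monic and moved to `Done` -/
  | redDone (s : Store n K) (A : Frame n K) (d : ℕ) (ToDo Done : Finset ℕ) (h : ℕ)
      (q : MvPolynomial (Fin n) K)
      (hh : h ∈ ToDo) (hmin : ∀ k ∈ ToDo, ¬ Sig.lt o (s.sig k) (s.sig h))
      (hq : IsNormalForm o A.base (s.poly h) q) (hq0 : q ≠ 0)
      (hnone : ∀ j, ¬ s.IsReductor o A.base (A.G ∪ Done) h q j) :
      Step o f (.red s A d ToDo Done)
        (.red (s.setPoly h (C (o.leadingCoeff q)⁻¹ * q)) A d (ToDo.erase h) (insert h Done))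
  /-- `TopReduction` reduces `r_h` by a multiple of `r_j` of smaller signature; `r_h` stays in
  `ToDo` -/
  | redSafe (s : Store n K) (A : Frame n K) (d : ℕ) (ToDo Done : Finset ℕ) (h j : ℕ)
      (q : MvPolynomial (Fin n) K)
      (hh : h ∈ ToDo) (hmin : ∀ k ∈ ToDo, ¬ Sig.lt o (s.sig k) (s.sig h))
      (hq : IsNormalForm o A.base (s.poly h) q) (hq0 : q ≠ 0)
      (hj : s.IsReductor o A.base (A.G ∪ Done) h q j)
      (hlt : Sig.lt o ((s.sig j).mul (o.degree q - s.hm o j)) (s.sig h)) :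
      Step o f (.red s A d ToDo Done)
        (.red
          (s.setPoly h (q - monomial (o.degree q - s.hm o j) (o.leadingCoeff q) * s.poly j))
          A d ToDo Done)
  /-- `TopReduction` finds a reductor whose multiple does not have a smaller signature: `r_h` stays
  in `ToDo` and a new labeled polynomial is added to `ToDo` -/
  | redNew (s : Store n K) (A : Frame n K) (d : ℕ) (ToDo Done : Finset ℕ) (h j : ℕ)
      (q : MvPolynomial (Fin n) K)
      (hh : h ∈ ToDo) (hmin : ∀ k ∈ ToDo, ¬ Sig.lt o (s.sig k) (s.sig h))
      (hq : IsNormalForm o A.base (s.poly h) q) (hq0 : q ≠ 0)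
      (hj : s.IsReductor o A.base (A.G ∪ Done) h q j)
      (hlt : ¬ Sig.lt o ((s.sig j).mul (o.degree q - s.hm o j)) (s.sig h)) :
      Step o f (.red s A d ToDo Done)
        (.red
          ((s.setPoly h q).push ((s.sig j).mul (o.degree q - s.hm o j))
            (monomial (o.degree q - s.hm o j) (o.leadingCoeff q) * s.poly j - q))
          A d (insert (s.N + 1) ToDo) Done)
  /-- `Reduction` returns `R_d = Done` -/
  | redRet (s : Store n K) (A : Frame n K) (d : ℕ) (Done : Finset ℕ) :
      Step o f (.red s A d ∅ Done) (.ins s A d Done)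
  /-- one pass through the **for** cycle over `R_d` -/
  | insAdd (s : Store n K) (A : Frame n K) (d : ℕ) (Rd : Finset ℕ) (r : ℕ) (hr : r ∈ Rd) :
      Step o f (.ins s A d Rd)
        (.ins s
          { A with
            P := A.P ∪ A.G.biUnion (fun k => s.critPair o A.i A.base r k)
            G := insert r A.G }
          d (Rd.erase r))
  /-- the iteration of the **while** cycle ends -/
  | insRet (s : Store n K) (A : Frame n K) (d : ℕ) :
      Step o f (.ins s A d ∅) (.head s A)

/-- The initial state of `incrementalF5` on the input `f 1, …, f m`: `N = m`, there are no rules,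
`r_m = (F_m, f_m)` and `G_m = {r_m}`. -/
noncomputable def start (o : MonomialOrder (Fin n)) (m : ℕ) (f : ℕ → MvPolynomial (Fin n) K) :
    State n K :=
  .outer (Store.setInput o ⟨fun _ => ⟨⟨0, 0⟩, 0⟩, m, fun _ => []⟩ m (f m)) m {m}

/-- The states that occur in some execution on the input `f 1, …, f m`. -/
def Reachable (o : MonomialOrder (Fin n)) (m : ℕ) (f : ℕ → MvPolynomial (Fin n) K)
    (x : State n K) : Prop :=
  Relation.ReflTransGen (Step o f) (start o m f) x

/-- Every execution that starts in `x` reaches, after finitely many steps, a state with the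
property `Q`; it can neither run forever nor get stuck before that. -/
inductive Inevitable (o : MonomialOrder (Fin n)) (f : ℕ → MvPolynomial (Fin n) K)
    (Q : State n K → Prop) : State n K → Prop
  | now (x : State n K) (hx : Q x) : Inevitable o f Q x
  | later (x : State n K) (hne : ∃ y, Step o f x y)
      (hall : ∀ y, Step o f x y → Inevitable o f Q y) : Inevitable o f Q x

/-- The execution is at the test of the **while** cycle of `AlgorithmF5` with index `i`. -/
def AtHead (i : ℕ) (x : State n K) : Prop :=
  ∃ s A, x = .head s A ∧ A.i = i

/-- In the state `x` an iteration of the **while** cycle of `AlgorithmF5` with index `i` starts,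
in which the variable `d` has the value `d`. -/
def StartsIteration (i : ℕ) (x : State n K) (d : ℕ) : Prop :=
  ∃ s A, x = .head s A ∧ A.i = i ∧ IsFirstDegree A.P d

/-- An execution leads from the start `x` of an iteration of the **while** cycle of `AlgorithmF5`
with index `i`, in which the variable `d` has the value `d`, to the end `y` of this iteration. -/
def Iteration (o : MonomialOrder (Fin n)) (f : ℕ → MvPolynomial (Fin n) K) (i : ℕ)
    (x : State n K) (d : ℕ) (y : State n K) : Prop :=
  StartsIteration i x d ∧ AtHead i y ∧
    ∃ z, Step o f x z ∧
      Relation.ReflTransGen (fun a b => (∀ i', ¬ AtHead i' a) ∧ Step o f a b) z y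

end Semantics

end F5

/-! Give the signature t F_k the degree deg t + deg f_k. All input is homogeneous, so each
polynomial part is homogeneous of the degree of its signature. Whatever an iteration of degree d
creates has a signature of index i and degree d, and there are only finitely many of these.

Termination of Reduction: a reduction by a smaller signature lowers a head monomial among the
finitely many monomials of degree d, so only the creation of new labeled polynomials could go on
forever. Let such a polynomial arise from a multiple u r_j. If r_j were in `Done`, its head monomial
would have degree d, so u = 1. Signatures in `Done` do not exceed those in `ToDo`, so u r_j would
have the signature of r_h, which (d) excludes. Hence r_j lies in G_i. As u r_j is not rewritable, no
rule for its signature is newer than r_j; the rule now added is newer than all of G_i, so this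
signature cannot be used again (`RedInv.numFreeSigs_push_lt`). A lexicographic induction finishes
(`RedInv.inevitable`).

Growth of d: let r_h enter `Done` and let r_j in G_i or `Done` form a pair of degree d with it. The
lcm is then the head monomial of r_h, so r_j satisfies (a) but fails (b), (c) or (d). If (b) fails,
CritPair rejects the pair; if (c) fails, Spol does. If (d) fails, two multiples share a signature,
and one of them is rewritable because the newest matching rule belongs to only one labeled
polynomial (`RedInv.dead_of_no_reductor`). Added rules do not revive such a pair. Thus an iteration
of degree d leaves only pairs of degree at least d, those of degree d being useless. If the next
iteration has degree d again, it creates nothing, and only larger degrees remain (`Iteration.lt`).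

Each new call has a smaller index, so an infinite execution stays in one call, whose iterations all
end; there must be infinitely many of them. -/

namespace F5

/-! ### Homogeneous normal forms and top reduction. -/

section Reduction

variable {n : ℕ} {K : Type*} [Field K] {o : MonomialOrder (Fin n)}
  {B : Set (MvPolynomial (Fin n) K)} {p q b : MvPolynomial (Fin n) K} {c : Fin n →₀ ℕ} {d D : ℕ}

lemma degree_hm (hp : p.IsHomogeneous d) (h0 : p ≠ 0) : (o.degree p).degree = d :=
  (hp.degree_eq_sum_deg_support (o.degree_mem_support h0)).symm

lemma isHomogeneous_monomial_mul (u : Fin n →₀ ℕ) (a : K) (hp : p.IsHomogeneous d)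
    (hD : u.degree + d = D) : (monomial u a * p).IsHomogeneous D :=
  hD ▸ (isHomogeneous_monomial a rfl).mul hp

/-- The cofactor has degree zero, hence is trivial. This is how pairs and reductors of the current
degree d are recognized as having multiplier 1. -/
lemma eq_of_le_of_degree_eq {a b : Fin n →₀ ℕ} (h : a ≤ b) (hd : a.degree = b.degree) :
    a = b := by
  have h1 := congrArg Finsupp.degree (tsub_add_cancel_of_le h)
  rw [map_add] at h1
  have h2 : (b - a).degree = 0 := by omega
  rw [Finsupp.degree_eq_zero_iff] at h2
  exact le_antisymm h (tsub_eq_zero_iff_le.mp h2)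

/-- Subtracting a multiple of `b` whose head monomial is `c` changes only monomials up to `c`. -/
lemma toSyn_degree_monomial_mul_le (hc : o.degree b ≤ c) (a : K) :
    o.toSyn (o.degree (monomial (c - o.degree b) a * b)) ≤ o.toSyn c := by
  refine (o.degree_mul_le).trans ?_
  conv_rhs => rw [← tsub_add_cancel_of_le hc]
  rw [map_add, map_add]
  gcongr
  exact o.degree_monomial_le a

lemma coeff_monomial_mul_top (hc : o.degree b ≤ c) (a : K) :
    (monomial (c - o.degree b) a * b).coeff c = a * o.leadingCoeff b := by
  rw [coeff_monomial_mul', if_pos tsub_le_self, tsub_tsub_cancel_of_le hc]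
  rfl

lemma coeff_redStep_of_lt (hc : o.degree b ≤ c) (a : K) {c' : Fin n →₀ ℕ}
    (h : o.toSyn c < o.toSyn c') :
    (p - monomial (c - o.degree b) a * b).coeff c' = p.coeff c' := by
  rw [coeff_sub, o.coeff_eq_zero_of_lt ((toSyn_degree_monomial_mul_le hc a).trans_lt h), sub_zero]

lemma coeff_redStep_self (hb : b ≠ 0) (hc : o.degree b ≤ c) :
    (p - monomial (c - o.degree b) (p.coeff c / o.leadingCoeff b) * b).coeff c = 0 := by
  rw [coeff_sub, coeff_monomial_mul_top hc,
    div_mul_cancel₀ _ (o.leadingCoeff_ne_zero_iff.mpr hb), sub_self]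

/-- The multiple of `b` that is subtracted has the degree of the eliminated monomial `c`, which is a
monomial of `p`. -/
lemma RedStep.isHomogeneous (hB : ∀ b ∈ B, ∃ D, b.IsHomogeneous D) (h : RedStep o B p q)
    (hp : p.IsHomogeneous d) : q.IsHomogeneous d := by
  obtain ⟨b, hb, hb0, c, hc, hle, rfl⟩ := h
  obtain ⟨D, hD⟩ := hB b hb
  refine hp.sub (isHomogeneous_monomial_mul _ _ hD ?_)
  rw [hp.degree_eq_sum_deg_support hc, ← degree_hm hD hb0 (o := o), ← map_add,
    tsub_add_cancel_of_le hle, Finsupp.degree_apply]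

lemma RedStep.toSyn_degree_le (h : RedStep o B p q) :
    o.toSyn (o.degree q) ≤ o.toSyn (o.degree p) := by
  obtain ⟨b, -, -, c, hc, hle, rfl⟩ := h
  exact o.degree_sub_le.trans
    (sup_le le_rfl ((toSyn_degree_monomial_mul_le hle _).trans (o.le_degree hc)))

lemma not_redStep_zero : ¬ RedStep o B 0 q := by
  rintro ⟨b, -, -, c, hc, -⟩
  simp at hc

lemma IsNormalForm.isHomogeneous (hB : ∀ b ∈ B, ∃ D, b.IsHomogeneous D)
    (h : IsNormalForm o B p q) (hp : p.IsHomogeneous d) : q.IsHomogeneous d := by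
  obtain ⟨h, -⟩ := h
  induction h with
  | refl => exact hp
  | tail _ hs ih => exact hs.isHomogeneous hB ih

lemma IsNormalForm.toSyn_degree_le (h : IsNormalForm o B p q) :
    o.toSyn (o.degree q) ≤ o.toSyn (o.degree p) := by
  obtain ⟨h, -⟩ := h
  induction h with
  | refl => exact le_rfl
  | tail _ hs ih => exact hs.toSyn_degree_le.trans ih

lemma IsNormalForm.ne_zero (h : IsNormalForm o B p q) (hq : q ≠ 0) : p ≠ 0 := by
  rintro rfl
  rcases h.1.cases_head with h' | ⟨_, h', -⟩
  · exact hq h'.symm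
  · exact not_redStep_zero h'

lemma IsNormalForm.not_degree_le (h : IsNormalForm o B p q) (hq : q ≠ 0) (hb : b ∈ B)
    (hb0 : b ≠ 0) : ¬ o.degree b ≤ o.degree q :=
  fun hle => h.2 _ ⟨b, hb, hb0, _, o.degree_mem_support hq, hle, rfl⟩

/-- Every polynomial has a normal form: always eliminate the greatest reducible monomial. -/
lemma exists_isNormalForm (o : MonomialOrder (Fin n)) (B : Set (MvPolynomial (Fin n) K))
    (p : MvPolynomial (Fin n) K) : ∃ q, IsNormalForm o B p q := by
  classical
  let red : (Fin n →₀ ℕ) → Prop := fun c => ∃ b ∈ B, b ≠ 0 ∧ o.degree b ≤ c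
  induction ha : (p.support.filter red).sup (fun c => (o.toSyn c : WithBot o.syn))
    using WellFoundedLT.induction generalizing p with
  | ind a ih =>
    by_cases hne : (p.support.filter red).Nonempty
    swap
    · refine ⟨p, .refl, ?_⟩
      rintro q ⟨b, hb, hb0, c, hc, hle, -⟩
      exact hne ⟨c, Finset.mem_filter.mpr ⟨hc, b, hb, hb0, hle⟩⟩
    obtain ⟨c, hc, hmax⟩ := Finset.exists_max_image _ o.toSyn hne
    obtain ⟨hcp, b, hb, hb0, hle⟩ := Finset.mem_filter.mp hc
    have hca : (o.toSyn c : WithBot o.syn) ≤ a :=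
      ha ▸ Finset.le_sup (f := fun c => (o.toSyn c : WithBot o.syn)) hc
    set p' := p - monomial (c - o.degree b) (p.coeff c / o.leadingCoeff b) * b with hp'
    have hlt : ∀ c' ∈ p'.support.filter red,
        (o.toSyn c' : WithBot o.syn) < (o.toSyn c : WithBot o.syn) := by
      intro c' hc'
      obtain ⟨hc', hr⟩ := Finset.mem_filter.mp hc'
      rw [WithBot.coe_lt_coe]
      by_contra hnot
      rcases (not_lt.mp hnot).lt_or_eq with h | h
      · rw [mem_support_iff, hp', coeff_redStep_of_lt hle _ h] at hc'
        exact (hmax c' (Finset.mem_filter.mpr ⟨mem_support_iff.mpr hc', hr⟩)).not_gt h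
      · obtain rfl := o.toSyn.injective h
        exact mem_support_iff.mp hc' (coeff_redStep_self hb0 hle)
    obtain ⟨q, hq1, hq2⟩ := ih _
      (((Finset.sup_lt_iff (WithBot.bot_lt_coe _)).mpr hlt).trans_le hca) p' rfl
    exact ⟨q, .head ⟨b, hb, hb0, c, hcp, hle, rfl⟩ hq1, hq2⟩

lemma degree_C_inv_mul (hq : q ≠ 0) :
    o.degree (C (o.leadingCoeff q)⁻¹ * q) = o.degree q := by
  have h := inv_ne_zero (o.leadingCoeff_ne_zero_iff.mpr hq)
  rw [o.degree_mul (by simpa using hq) hq, o.degree_C, zero_add]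

lemma leadingCoeff_C_inv_mul (hq : q ≠ 0) :
    o.leadingCoeff (C (o.leadingCoeff q)⁻¹ * q) = 1 := by
  rw [MonomialOrder.leadingCoeff, degree_C_inv_mul hq, coeff_C_mul]
  exact inv_mul_cancel₀ (o.leadingCoeff_ne_zero_iff.mpr hq)

/-- The number of monomials of degree `d` up to the head monomial of `p`. -/
noncomputable def rank (o : MonomialOrder (Fin n)) (d : ℕ) (p : MvPolynomial (Fin n) K) : ℕ :=
  {c : Fin n →₀ ℕ | c.degree = d ∧ p ≠ 0 ∧ o.toSyn c ≤ o.toSyn (o.degree p)}.ncard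

/-- A top reduction of the normal form of `p` by a monic polynomial decreases the rank. -/
lemma rank_topReduction_lt (hB : ∀ b ∈ B, ∃ D, b.IsHomogeneous D) (hp : p.IsHomogeneous d)
    (hq : IsNormalForm o B p q) (hq0 : q ≠ 0) (hb : o.leadingCoeff b = 1)
    (hle : o.degree b ≤ o.degree q) :
    rank o d (q - monomial (o.degree q - o.degree b) (o.leadingCoeff q) * b) < rank o d p := by
  have hqd := hq.isHomogeneous hB hp
  set r := q - monomial (o.degree q - o.degree b) (o.leadingCoeff q) * b with hr
  have hr1 : o.toSyn (o.degree r) ≤ o.toSyn (o.degree q) :=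
    o.degree_sub_le.trans (sup_le le_rfl (toSyn_degree_monomial_mul_le hle _))
  have hr2 : r.coeff (o.degree q) = 0 := by
    rw [hr, coeff_sub, coeff_monomial_mul_top hle, hb, mul_one]
    exact sub_self _
  refine Set.ncard_lt_ncard ⟨?_, ?_⟩ ((Finsupp.finite_of_degree_eq d).subset fun c hc => hc.1)
  · rintro c ⟨h1, h2, h3⟩
    exact ⟨h1, hq.ne_zero hq0, h3.trans (hr1.trans hq.toSyn_degree_le)⟩
  -- Strictness comes from the head monomial of `q`: it is counted for `p`, but its coefficient in
  -- `r` vanishes because `b` is monic. The nonvanishing clause in `rank` settles the case `r = 0`,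
  -- where comparing `o.degree` alone could fail to separate the two.
  · intro hsub
    obtain ⟨-, h2, h3⟩ := hsub
      ⟨degree_hm hqd hq0, hq.ne_zero hq0, hq.toSyn_degree_le⟩
    have := o.toSyn.injective (le_antisymm hr1 h3)
    rw [← this] at hr2
    exact h2 (o.coeff_degree_eq_zero_iff.mp hr2)

end Reduction

/-! ### Signatures, rewriting, discarded pairs, and invariants of the global and local variables. -/

section Invariants

variable {n : ℕ} {K : Type*} [Field K] {o : MonomialOrder (Fin n)}
  {B : Set (MvPolynomial (Fin n) K)} {p : MvPolynomial (Fin n) K} {u : Fin n →₀ ℕ}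
  {s : Store n K} {S : Sig n} {e : ℕ → ℕ} {m i d h k l N : ℕ}

/-- The degree of a signature, where `e k` is the degree of the `k`-th input polynomial. -/
noncomputable def Sig.deg (e : ℕ → ℕ) (S : Sig n) : ℕ := S.mon.degree + e S.idx

lemma Sig.deg_mul : (S.mul u).deg e = u.degree + S.deg e := by
  simp [Sig.deg, Sig.mul, add_assoc]

lemma Sig.lt_iff_of_idx_eq {S T : Sig n} (h : S.idx = T.idx) :
    Sig.lt o S T ↔ o.toSyn S.mon < o.toSyn T.mon := by
  simp [Sig.lt, h]

lemma Sig.eq_of_not_lt {S T : Sig n} (h : S.idx = T.idx) (h1 : ¬ Sig.lt o S T)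
    (h2 : ¬ Sig.lt o T S) : S = T := by
  rw [lt_iff_of_idx_eq h, not_lt] at h1
  rw [lt_iff_of_idx_eq h.symm, not_lt] at h2
  obtain ⟨a, i⟩ := S
  obtain ⟨b, j⟩ := T
  obtain rfl : i = j := h
  obtain rfl : a = b := o.toSyn.injective (le_antisymm h2 h1)
  rfl

namespace Store

@[simp] lemma sig_setPoly : (s.setPoly h p).sig k = s.sig k := by
  unfold setPoly sig
  by_cases hk : k = h
  · subst hk; simp
  · simp [hk]

@[simp] lemma poly_setPoly_self : (s.setPoly h p).poly h = p := by
  simp [setPoly, poly]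

lemma R_setPoly_of_ne (hk : k ≠ h) : (s.setPoly h p).R k = s.R k := by
  simp [setPoly, hk]

lemma poly_setPoly_of_ne (hk : k ≠ h) : (s.setPoly h p).poly k = s.poly k := by
  simp [poly, R_setPoly_of_ne hk]

@[simp] lemma N_setPoly : (s.setPoly h p).N = s.N := rfl

@[simp] lemma Rule_setPoly : (s.setPoly h p).Rule = s.Rule := rfl

@[simp] lemma N_push : (s.push S p).N = s.N + 1 := rfl

lemma R_push_of_ne (hk : k ≠ s.N + 1) : (s.push S p).R k = s.R k := by
  simp [push, hk]

lemma sig_push_of_ne (hk : k ≠ s.N + 1) : (s.push S p).sig k = s.sig k := by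
  simp [sig, R_push_of_ne hk]

lemma poly_push_of_ne (hk : k ≠ s.N + 1) : (s.push S p).poly k = s.poly k := by
  simp [poly, R_push_of_ne hk]

@[simp] lemma sig_push_self : (s.push S p).sig (s.N + 1) = S := by
  simp [push, sig]

@[simp] lemma poly_push_self : (s.push S p).poly (s.N + 1) = p := by
  simp [push, poly]

lemma Rule_push : (s.push S p).Rule l =
    if l = S.idx then (S.mon, s.N + 1) :: s.Rule l else s.Rule l := by
  simp only [push, Function.update_apply]
  split_ifs with hl <;> simp [*]

lemma Rule_subset_push : s.Rule l ⊆ (s.push S p).Rule l := by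
  rw [Rule_push]
  split_ifs <;> simp

open Classical in
lemma rewritten_iff : s.Rewritten u k ↔
    ∃ ρ, (s.Rule (s.sig k).idx).find? (fun ρ => decide (ρ.1 ≤ u + (s.sig k).mon)) = some ρ ∧
      ρ.2 ≠ k := by
  unfold Rewritten rewrite
  split <;> simp [*]

@[simp] lemma rewritten_setPoly : (s.setPoly h p).Rewritten u k ↔ s.Rewritten u k := by
  simp [rewritten_iff]

/-- A multiple that is rewritable remains so when a rule is added. -/
lemma Rewritten.push (h : s.Rewritten u k) (hk : k ≠ s.N + 1) :
    (s.push S p).Rewritten u k := by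
  rw [rewritten_iff] at h ⊢
  obtain ⟨ρ, h1, h2⟩ := h
  rw [sig_push_of_ne hk, Rule_push]
  split_ifs with hl
  · rw [List.find?_cons]
    split
    · exact ⟨_, rfl, hk.symm⟩
    · exact ⟨ρ, h1, h2⟩
  · exact ⟨ρ, h1, h2⟩

/-- The pair of `r_a` and `r_b` is discarded by `CritPair` or by `Spol`. -/
def Dead (o : MonomialOrder (Fin n)) (s : Store n K) (i : ℕ) (B : Set (MvPolynomial (Fin n) K))
    (a b : ℕ) : Prop :=
  (s.sig a).idx = i ∧ (s.sig b).idx = i ∧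
    (¬ FixedMon o B (s.hm o a ⊔ s.hm o b - s.hm o a + (s.sig a).mon) ∨
      ¬ FixedMon o B (s.hm o a ⊔ s.hm o b - s.hm o b + (s.sig b).mon) ∨
      s.Rewritten (s.hm o a ⊔ s.hm o b - s.hm o a) a ∨
      s.Rewritten (s.hm o a ⊔ s.hm o b - s.hm o b) b)

lemma Dead.symm {a b : ℕ} (h : s.Dead o i B a b) : s.Dead o i B b a := by
  unfold Dead at h ⊢
  rw [sup_comm (s.hm o b)]
  tauto

/-- Dead pairs remain dead if the two labeled polynomials do not change and if rewritability is
preserved. -/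
lemma Dead.mono {a b : ℕ} {s' : Store n K} (h : s.Dead o i B a b) (ha : s'.R a = s.R a)
    (hb : s'.R b = s.R b) (ha' : ∀ u, s.Rewritten u a → s'.Rewritten u a)
    (hb' : ∀ u, s.Rewritten u b → s'.Rewritten u b) : s'.Dead o i B a b := by
  obtain ⟨h1, h2, h3⟩ := h
  have e1 : s'.sig a = s.sig a := by simp [sig, ha]
  have e2 : s'.sig b = s.sig b := by simp [sig, hb]
  have e3 : s'.hm o a = s.hm o a := by simp [hm, poly, ha]
  have e4 : s'.hm o b = s.hm o b := by simp [hm, poly, hb]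
  unfold Dead
  rw [e1, e2, e3, e4]
  exact ⟨h1, h2, h3.imp_right (Or.imp_right (Or.imp (ha' _) (hb' _)))⟩

/-- The exchange of the two parts only decides which generator comes first. Leaving that order open
lets later arguments treat both cases symmetrically. -/
lemma mem_critPair {c : CritPair n} (hc : c ∈ s.critPair o i B k l) :
    ∃ a b, (a = k ∧ b = l ∨ a = l ∧ b = k) ∧
      c = ⟨s.hm o a ⊔ s.hm o b, s.hm o a ⊔ s.hm o b - s.hm o a, a,
        s.hm o a ⊔ s.hm o b - s.hm o b, b⟩ ∧
      (s.sig a).idx ≤ i ∧ FixedMon o B (s.hm o a ⊔ s.hm o b - s.hm o a + (s.sig a).mon) ∧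
      ((s.sig b).idx = i →
        FixedMon o B (s.hm o a ⊔ s.hm o b - s.hm o b + (s.sig b).mon)) := by
  have key : ∃ a b, (a = k ∧ b = l ∨ a = l ∧ b = k) ∧ c ∈ s.critPairOrdered o i B a b := by
    unfold critPair at hc
    dsimp only at hc
    split_ifs at hc
    · exact ⟨l, k, Or.inr ⟨rfl, rfl⟩, hc⟩
    · exact ⟨k, l, Or.inl ⟨rfl, rfl⟩, hc⟩
  obtain ⟨a, b, hab, h⟩ := key
  unfold critPairOrdered at h
  dsimp only at h
  split_ifs at h with hif
  · simp at h
  · push Not at hif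
    exact ⟨a, b, hab, Finset.mem_singleton.mp h, hif⟩

lemma deg_of_mem_critPair {c : CritPair n} (hc : c ∈ s.critPair o i B k l) :
    c.deg = (s.hm o k ⊔ s.hm o l).degree := by
  obtain ⟨a, b, ⟨rfl, rfl⟩ | ⟨rfl, rfl⟩, rfl, -⟩ := mem_critPair hc
  · rfl
  · rw [sup_comm]; rfl

/-- The pair `c` is discarded by `Spol`. -/
def Skipped (s : Store n K) (c : CritPair n) : Prop :=
  s.Rewritten c.u₁ c.k₁ ∨ s.Rewritten c.u₂ c.k₂

/-- A pair returned by `critPair` has passed the test of φ on both parts; the second part was tested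
too because its index is `i`. Of the reasons for being dead, only rewritability is left. -/
lemma Dead.skipped {c : CritPair n} (h : s.Dead o i B k l) (hc : c ∈ s.critPair o i B k l) :
    s.Skipped c := by
  obtain ⟨a, b, hab, rfl, -, h1, h2⟩ := mem_critPair hc
  have hd : s.Dead o i B a b := by
    rcases hab with ⟨rfl, rfl⟩ | ⟨rfl, rfl⟩
    · exact h
    · exact h.symm
  obtain ⟨-, hb, h3⟩ := hd
  rcases h3 with h3 | h3 | h3
  · exact (h3 h1).elim
  · exact (h3 (h2 hb)).elim
  · exact h3

/-- The properties of a critical pair of elements of `G`. -/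
structure ValidPair (o : MonomialOrder (Fin n)) (s : Store n K) (i : ℕ) (G : Finset ℕ)
    (c : CritPair n) : Prop where
  mem₁ : c.k₁ ∈ G
  mem₂ : c.k₂ ∈ G
  eq₁ : c.u₁ + s.hm o c.k₁ = c.t
  eq₂ : c.u₂ + s.hm o c.k₂ = c.t
  idx : (s.sig c.k₁).idx = i

lemma ValidPair.congr {G : Finset ℕ} {c : CritPair n} {s' : Store n K}
    (h : ValidPair o s i G c) (hR : ∀ k ∈ G, s'.R k = s.R k) : ValidPair o s' i G c where
  mem₁ := h.mem₁
  mem₂ := h.mem₂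
  eq₁ := by simpa [hm, poly, hR _ h.mem₁] using h.eq₁
  eq₂ := by simpa [hm, poly, hR _ h.mem₂] using h.eq₂
  idx := by simpa [sig, hR _ h.mem₁] using h.idx

lemma ValidPair.mono {G G' : Finset ℕ} {c : CritPair n} (h : ValidPair o s i G c)
    (hG : G ⊆ G') : ValidPair o s i G' c :=
  ⟨hG h.mem₁, hG h.mem₂, h.eq₁, h.eq₂, h.idx⟩

/-- The index of the first part is exactly `i`: `critPair` excludes larger indices, and `G` contains
no smaller ones. -/
lemma validPair_of_mem_critPair {G : Finset ℕ} {c : CritPair n} (hc : c ∈ s.critPair o i B k l)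
    (hk : k ∈ G) (hl : l ∈ G) (hG : ∀ k ∈ G, i ≤ (s.sig k).idx) : ValidPair o s i G c := by
  obtain ⟨a, b, hab, rfl, h1, -⟩ := mem_critPair hc
  have ha : a ∈ G := by rcases hab with ⟨rfl, rfl⟩ | ⟨rfl, rfl⟩ <;> assumption
  have hb : b ∈ G := by rcases hab with ⟨rfl, rfl⟩ | ⟨rfl, rfl⟩ <;> assumption
  exact ⟨ha, hb, tsub_add_cancel_of_le le_sup_left, tsub_add_cancel_of_le le_sup_right,
    le_antisymm h1 (hG _ ha)⟩

end Store

/-- The invariants of the global variables during the call with index `i`. -/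
structure StoreInv (e : ℕ → ℕ) (m i : ℕ) (s : Store n K) : Prop where
  le_m : i ≤ m
  le_N : m ≤ s.N
  hom : ∀ k, i ≤ k → k ≤ s.N → (s.poly k).IsHomogeneous ((s.sig k).deg e)
  sorted : ∀ l, (s.Rule l).Pairwise (fun a b => b.2 < a.2)
  rule_le : ∀ l, ∀ ρ ∈ s.Rule l, ρ.2 ≤ s.N
  rule_mem : ∀ k, m < k → k ≤ s.N → ((s.sig k).mon, k) ∈ s.Rule (s.sig k).idx

lemma StoreInv.setPoly (hs : StoreInv e m i s) (hp : p.IsHomogeneous ((s.sig h).deg e)) :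
    StoreInv e m i (s.setPoly h p) where
  le_m := hs.le_m
  le_N := hs.le_N
  hom k h1 h2 := by
    rw [Store.sig_setPoly]
    by_cases hk : k = h
    · subst hk; simpa using hp
    · rw [Store.poly_setPoly_of_ne hk]; exact hs.hom k h1 h2
  sorted := hs.sorted
  rule_le := hs.rule_le
  rule_mem k h1 h2 := by simpa using hs.rule_mem k h1 h2

lemma StoreInv.push (hs : StoreInv e m i s) (hp : p.IsHomogeneous (S.deg e)) :
    StoreInv e m i (s.push S p) where
  le_m := hs.le_m
  le_N := hs.le_N.trans (Nat.le_succ _)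
  hom k h1 h2 := by
    by_cases hk : k = s.N + 1
    · subst hk; simpa using hp
    · rw [Store.sig_push_of_ne hk, Store.poly_push_of_ne hk]
      rw [Store.N_push] at h2
      exact hs.hom k h1 (by omega)
  sorted l := by
    rw [Store.Rule_push]
    split_ifs
    · exact List.pairwise_cons.mpr
        ⟨fun ρ hρ => Nat.lt_succ_of_le (hs.rule_le _ ρ hρ), hs.sorted l⟩
    · exact hs.sorted l
  rule_le l ρ hρ := by
    rw [Store.Rule_push] at hρ
    rw [Store.N_push]
    split_ifs at hρ
    · rcases List.mem_cons.mp hρ with rfl | hρ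
      · exact le_rfl
      · exact (hs.rule_le _ ρ hρ).trans (Nat.le_succ _)
    · exact (hs.rule_le _ ρ hρ).trans (Nat.le_succ _)
  rule_mem k h1 h2 := by
    by_cases hk : k = s.N + 1
    · subst hk
      simp [Store.Rule_push]
    · rw [Store.N_push] at h2
      rw [Store.sig_push_of_ne hk]
      exact Store.Rule_subset_push (hs.rule_mem k h1 (by omega))

/-- Rule lists are strictly decreasing in position, so the first hit of the search is the newest
one. -/
lemma List.le_of_find?_eq_some {α : Type*} {P : α × ℕ → Bool} {L : List (α × ℕ)}
    (hL : L.Pairwise (fun a b => b.2 < a.2)) {ρ x : α × ℕ} (hρ : L.find? P = some ρ)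
    (hx : x ∈ L) (hPx : P x) : x.2 ≤ ρ.2 := by
  induction L with
  | nil => simp at hx
  | cons y L ih =>
    rw [List.pairwise_cons] at hL
    rw [List.find?_cons] at hρ
    split at hρ
    · obtain rfl : y = ρ := by simpa using hρ
      rcases List.mem_cons.mp hx with rfl | hx
      · exact le_rfl
      · exact (hL.1 x hx).le
    · rcases List.mem_cons.mp hx with rfl | hx
      · simp_all
      · exact ih hL.2 hρ hx

/-- If a multiple of `r_k` is not rewritable, then no rule that divides it is newer than `r_k`. -/
lemma StoreInv.rule_le_of_not_rewritten (hs : StoreInv e m i s) (hr : ¬ s.Rewritten u k)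
    {ρ : (Fin n →₀ ℕ) × ℕ} (hρ : ρ ∈ s.Rule (s.sig k).idx) (hle : ρ.1 ≤ u + (s.sig k).mon) :
    ρ.2 ≤ k := by
  classical
  rw [Store.rewritten_iff] at hr
  push Not at hr
  cases hf : (s.Rule (s.sig k).idx).find? (fun ρ => decide (ρ.1 ≤ u + (s.sig k).mon)) with
  | none =>
    rw [List.find?_eq_none] at hf
    simpa [hle] using hf ρ hρ
  | some ρ' =>
    rw [← hr ρ' (by convert hf)]
    exact List.le_of_find?_eq_some (hs.sorted _) hf hρ (by simpa using hle)

/-- The invariants of the local variables of a call. -/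
structure FrameInv (o : MonomialOrder (Fin n)) (s : Store n K) (A : Frame n K) : Prop where
  ge : ∀ k ∈ A.G, A.i ≤ k
  le : ∀ k ∈ A.G, k ≤ s.N
  monic : ∀ k ∈ A.G, o.leadingCoeff (s.poly k) = 1
  idx : ∀ k ∈ A.G, A.i ≤ (s.sig k).idx
  base : ∀ k ∈ A.G, A.i < (s.sig k).idx → s.poly k ∈ A.base
  hom : ∀ b ∈ A.base, ∃ D, b.IsHomogeneous D
  pairs : ∀ c ∈ A.P, s.ValidPair o A.i A.G c

lemma FrameInv.congr {A : Frame n K} {s' : Store n K} (h : FrameInv o s A) (hN : s.N ≤ s'.N)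
    (hR : ∀ k ∈ A.G, s'.R k = s.R k) : FrameInv o s' A where
  ge := h.ge
  le k hk := (h.le k hk).trans hN
  monic k hk := by simpa [Store.poly, hR k hk] using h.monic k hk
  idx k hk := by simpa [Store.sig, hR k hk] using h.idx k hk
  base k hk := by simpa [Store.sig, Store.poly, hR k hk] using h.base k hk
  hom := h.hom
  pairs c hc := (h.pairs c hc).congr hR

/-- `r_h` was created in the current call and has a signature of degree `d`. -/
structure Fresh (e : ℕ → ℕ) (m i d : ℕ) (s : Store n K) (h : ℕ) : Prop where
  gt : m < h
  le : h ≤ s.N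
  idx : (s.sig h).idx = i
  deg : (s.sig h).deg e = d

lemma Fresh.setPoly (hf : Fresh e m i d s k) : Fresh e m i d (s.setPoly h p) k :=
  ⟨hf.gt, hf.le, by simpa using hf.idx, by simpa using hf.deg⟩

lemma Fresh.push (hf : Fresh e m i d s k) : Fresh e m i d (s.push S p) k := by
  have hk : k ≠ s.N + 1 := by have := hf.le; omega
  exact ⟨hf.gt, hf.le.trans (Nat.le_succ _), by simpa [Store.sig_push_of_ne hk] using hf.idx,
    by simpa [Store.sig_push_of_ne hk] using hf.deg⟩

lemma fresh_push_self (hs : m ≤ s.N) (hi : S.idx = i) (hd : S.deg e = d) :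
    Fresh e m i d (s.push S p) (s.N + 1) :=
  ⟨Nat.lt_succ_of_le hs, le_rfl, by simpa using hi, by simpa using hd⟩

lemma Fresh.isHomogeneous (hf : Fresh e m i d s k) (hs : StoreInv e m i s) :
    (s.poly k).IsHomogeneous d :=
  hf.deg ▸ hs.hom k (hs.le_m.trans hf.gt.le) hf.le

/-- If two different labeled polynomials have multiples of the same signature, and the second one
has a rule, then one of the multiples is rewritable. -/
lemma StoreInv.rewritten_or_rewritten (hs : StoreInv e m i s) {v : Fin n →₀ ℕ}
    (h1 : m < l) (h2 : l ≤ s.N) (hkl : k ≠ l)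
    (hsig : (s.sig k).mul u = (s.sig l).mul v) : s.Rewritten u k ∨ s.Rewritten v l := by
  classical
  obtain ⟨hmon, hidx⟩ := Sig.mk.inj hsig
  rw [Store.rewritten_iff, Store.rewritten_iff, hmon, hidx]
  -- Equal signatures make both tests search the same list for the same monomial. The rule of `r_l`
  -- itself guarantees a hit, and the hit cannot belong to both `k` and `l`.
  have hsome : ((s.Rule (s.sig l).idx).find?
      (fun ρ => decide (ρ.1 ≤ v + (s.sig l).mon))).isSome := by
    rw [List.find?_isSome]
    exact ⟨_, hs.rule_mem l h1 h2, by simp⟩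
  obtain ⟨ρ, hρ⟩ := Option.isSome_iff_exists.mp hsome
  by_cases hk : ρ.2 = k
  · exact Or.inr ⟨ρ, by convert hρ, fun h => hkl (hk.symm.trans h)⟩
  · exact Or.inl ⟨ρ, by convert hρ, hk⟩

end Invariants

/-! ### Invariants of Spol, Reduction and the insertion cycle. -/

section StateInvariants

variable {n : ℕ} {K : Type*} [Field K] {o : MonomialOrder (Fin n)}
  {p q : MvPolynomial (Fin n) K} {s : Store n K} {A : Frame n K} {S : Sig n}
  {e : ℕ → ℕ} {m i d h j k : ℕ} {Pd : Finset (CritPair n)} {F ToDo Done Rd : Finset ℕ}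

lemma StoreInv.degree_hm (hs : StoreInv e m i s) (h1 : i ≤ k) (h2 : k ≤ s.N)
    (hk : o.leadingCoeff (s.poly k) = 1) : (s.hm o k).degree = (s.sig k).deg e :=
  F5.degree_hm (hs.hom k h1 h2) fun h0 => by simp [h0] at hk

/-- The invariant at the test of the **while** cycle of `AlgorithmF5`. -/
structure HeadInv (o : MonomialOrder (Fin n)) (e : ℕ → ℕ) (m : ℕ) (s : Store n K)
    (A : Frame n K) : Prop where
  store : StoreInv e m A.i s
  frame : FrameInv o s A

/-- The invariant inside `Spol`. -/
structure SpolInv (o : MonomialOrder (Fin n)) (e : ℕ → ℕ) (m : ℕ) (s : Store n K)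
    (A : Frame n K) (d : ℕ) (Pd : Finset (CritPair n)) (F : Finset ℕ) : Prop
    extends HeadInv o e m s A where
  deg_gt : ∀ c ∈ A.P, d < c.deg
  valid : ∀ c ∈ Pd, s.ValidPair o A.i A.G c
  deg : ∀ c ∈ Pd, c.deg = d
  fresh : ∀ h ∈ F, Fresh e m A.i d s h
  gt : ∀ h ∈ F, ∀ g ∈ A.G, g < h

/-- The invariant inside `Reduction`. -/
structure RedInv (o : MonomialOrder (Fin n)) (e : ℕ → ℕ) (m : ℕ) (s : Store n K)
    (A : Frame n K) (d : ℕ) (ToDo Done : Finset ℕ) : Prop extends HeadInv o e m s A where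
  deg_gt : ∀ c ∈ A.P, d < c.deg
  fresh : ∀ h ∈ ToDo ∪ Done, Fresh e m A.i d s h
  gt : ∀ h ∈ ToDo ∪ Done, ∀ g ∈ A.G, g < h
  disj : Disjoint ToDo Done
  monic : ∀ k ∈ Done, o.leadingCoeff (s.poly k) = 1
  sig_le : ∀ k ∈ Done, ∀ h ∈ ToDo, ¬ Sig.lt o (s.sig h) (s.sig k)
  dead : ∀ k ∈ Done, ∀ j ∈ A.G ∪ Done, j ≠ k → (s.hm o k ⊔ s.hm o j).degree = d →
    s.Dead o A.i A.base k j

/-- The invariant inside the **for** cycle over `R_d`. -/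
structure InsInv (o : MonomialOrder (Fin n)) (e : ℕ → ℕ) (m : ℕ) (s : Store n K)
    (A : Frame n K) (d : ℕ) (Rd : Finset ℕ) : Prop extends HeadInv o e m s A where
  deg_ge : ∀ c ∈ A.P, d ≤ c.deg
  skipped : ∀ c ∈ A.P, c.deg = d → s.Skipped c
  fresh : ∀ h ∈ Rd, Fresh e m A.i d s h
  disj : ∀ h ∈ Rd, h ∉ A.G
  monic : ∀ k ∈ Rd, o.leadingCoeff (s.poly k) = 1
  dead : ∀ k ∈ Rd, ∀ j ∈ A.G ∪ Rd, j ≠ k → (s.hm o k ⊔ s.hm o j).degree = d →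
    s.Dead o A.i A.base k j

lemma HeadInv.spolInv (hI : HeadInv o e m s A) (hd : IsFirstDegree A.P d) :
    SpolInv o e m s { A with P := A.P.filter (fun p => p.deg ≠ d) } d
      (A.P.filter (fun p => p.deg = d)) ∅ where
  store := hI.store
  frame := { hI.frame with pairs := fun c hc => hI.frame.pairs c (Finset.mem_filter.mp hc).1 }
  deg_gt c hc := by
    obtain ⟨h1, h2⟩ := Finset.mem_filter.mp hc
    exact lt_of_le_of_ne (hd.2 c h1) (Ne.symm h2)
  valid c hc := hI.frame.pairs c (Finset.mem_filter.mp hc).1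
  deg c hc := (Finset.mem_filter.mp hc).2
  fresh := by simp
  gt := by simp

lemma SpolInv.erase (hI : SpolInv o e m s A d Pd F) (c : CritPair n) :
    SpolInv o e m s A d (Pd.erase c) F :=
  { hI with
    valid := fun c' hc' => hI.valid c' (Finset.mem_of_mem_erase hc')
    deg := fun c' hc' => hI.deg c' (Finset.mem_of_mem_erase hc') }

/-- The signature of a multiple of `r_k` has the degree of the multiple. -/
lemma HeadInv.deg_mul_sig (hI : HeadInv o e m s A) (hk : k ∈ A.G) {u t : Fin n →₀ ℕ}
    (hu : u + s.hm o k = t) : ((s.sig k).mul u).deg e = t.degree := by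
  rw [Sig.deg_mul, ← hI.store.degree_hm (hI.frame.ge k hk) (hI.frame.le k hk)
    (hI.frame.monic k hk), ← map_add, hu]

lemma HeadInv.isHomogeneous_mul (hI : HeadInv o e m s A) (hk : k ∈ A.G) {u t : Fin n →₀ ℕ}
    (hu : u + s.hm o k = t) (a : K) : (monomial u a * s.poly k).IsHomogeneous t.degree :=
  isHomogeneous_monomial_mul _ _ (hI.store.hom k (hI.frame.ge k hk) (hI.frame.le k hk))
    (by rw [← Sig.deg_mul, hI.deg_mul_sig hk hu])

lemma FrameInv.push (hA : FrameInv o s A) : FrameInv o (s.push S p) A :=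
  hA.congr (Nat.le_succ _) fun k hk => Store.R_push_of_ne (by have := hA.le k hk; omega)

/-- Both multiples are homogeneous of degree deg t = d, which is also the degree of the signature
taken from the first part. The position `s.N + 1` lies above all of `G`. -/
lemma SpolInv.add (hI : SpolInv o e m s A d Pd F) {c : CritPair n} (hc : c ∈ Pd) :
    SpolInv o e m
      (s.push ((s.sig c.k₁).mul c.u₁)
        (monomial c.u₁ 1 * s.poly c.k₁ - monomial c.u₂ 1 * s.poly c.k₂))
      A d (Pd.erase c) (insert (s.N + 1) F) := by
  have hv := hI.valid c hc
  have hd : c.t.degree = d := hI.deg c hc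
  have hsig := hI.deg_mul_sig hv.mem₁ hv.eq₁
  have hR : ∀ k ∈ A.G, k ≠ s.N + 1 := fun k hk => by have := hI.frame.le k hk; omega
  refine ⟨⟨hI.store.push ?_, hI.frame.push⟩, hI.deg_gt, fun c' hc' => ?_,
    fun c' hc' => hI.deg c' (Finset.mem_of_mem_erase hc'), fun h hh => ?_, fun h hh g hg => ?_⟩
  · rw [hsig]
    exact (hI.isHomogeneous_mul hv.mem₁ hv.eq₁ 1).sub (hI.isHomogeneous_mul hv.mem₂ hv.eq₂ 1)
  · exact (hI.valid c' (Finset.mem_of_mem_erase hc')).congr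
      fun k hk => Store.R_push_of_ne (hR k hk)
  · rcases Finset.mem_insert.mp hh with rfl | hh
    · exact fresh_push_self hI.store.le_N hv.idx (hsig.trans hd)
    · exact (hI.fresh h hh).push
  · rcases Finset.mem_insert.mp hh with rfl | hh
    · exact Nat.lt_succ_of_le (hI.frame.le g hg)
    · exact hI.gt h hh g hg

lemma SpolInv.redInv (hI : SpolInv o e m s A d Pd F) : RedInv o e m s A d F ∅ where
  toHeadInv := hI.toHeadInv
  deg_gt := hI.deg_gt
  fresh := by simpa using hI.fresh
  gt := by simpa using hI.gt
  disj := Finset.disjoint_empty_right _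
  monic := by simp
  sig_le := by simp
  dead := by simp

namespace RedInv

variable (hI : RedInv o e m s A d ToDo Done)
include hI

/-- Rewriting the polynomial part of an element of `ToDo` therefore never touches `G` or `Done`, so
facts about dead pairs stay valid. -/
lemma ne_of_mem_toDo (hh : h ∈ ToDo) (hj : j ∈ A.G ∪ Done) : j ≠ h := by
  rintro rfl
  rcases Finset.mem_union.mp hj with hj | hj
  · exact (hI.gt j (Finset.mem_union_left _ hh) j hj).false
  · exact Finset.disjoint_left.mp hI.disj hh hj

lemma le_N (hj : j ∈ A.G ∪ Done) : j ≤ s.N := by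
  rcases Finset.mem_union.mp hj with hj | hj
  · exact hI.frame.le j hj
  · exact (hI.fresh j (Finset.mem_union_right _ hj)).le

lemma idx_ge (hj : j ∈ A.G ∪ Done) : A.i ≤ (s.sig j).idx := by
  rcases Finset.mem_union.mp hj with hj | hj
  · exact hI.frame.idx j hj
  · exact (hI.fresh j (Finset.mem_union_right _ hj)).idx.ge

lemma leadingCoeff_eq_one (hj : j ∈ A.G ∪ Done) : o.leadingCoeff (s.poly j) = 1 := by
  rcases Finset.mem_union.mp hj with hj | hj
  · exact hI.frame.monic j hj
  · exact hI.monic j hj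

lemma index_le (hj : j ∈ A.G ∪ Done) : A.i ≤ j := by
  rcases Finset.mem_union.mp hj with hj | hj
  · exact hI.frame.ge j hj
  · exact hI.store.le_m.trans (hI.fresh j (Finset.mem_union_right _ hj)).gt.le

lemma deg_mul_sig (hj : j ∈ A.G ∪ Done) {u t : Fin n →₀ ℕ} (hu : u + s.hm o j = t) :
    ((s.sig j).mul u).deg e = t.degree := by
  rw [Sig.deg_mul, ← hI.store.degree_hm (hI.index_le hj) (hI.le_N hj)
    (hI.leadingCoeff_eq_one hj), ← map_add, hu]

lemma isHomogeneous_mul (hj : j ∈ A.G ∪ Done) {u t : Fin n →₀ ℕ} (hu : u + s.hm o j = t)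
    (a : K) : (monomial u a * s.poly j).IsHomogeneous t.degree :=
  isHomogeneous_monomial_mul _ _ (hI.store.hom j (hI.index_le hj) (hI.le_N hj))
    (by rw [← Sig.deg_mul, hI.deg_mul_sig hj hu])

lemma isHomogeneous (hh : h ∈ ToDo) : (s.poly h).IsHomogeneous d :=
  (hI.fresh h (Finset.mem_union_left _ hh)).isHomogeneous hI.store

lemma isHomogeneous_normalForm (hh : h ∈ ToDo) (hq : IsNormalForm o A.base (s.poly h) q) :
    q.IsHomogeneous d :=
  hq.isHomogeneous hI.frame.hom (hI.isHomogeneous hh)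

lemma setPoly (hh : h ∈ ToDo) (hp : p.IsHomogeneous d) :
    RedInv o e m (s.setPoly h p) A d ToDo Done := by
  have hR : ∀ j ∈ A.G ∪ Done, (s.setPoly h p).R j = s.R j := fun j hj =>
    Store.R_setPoly_of_ne (hI.ne_of_mem_toDo hh hj)
  have hR' : ∀ j ∈ A.G ∪ Done, (s.setPoly h p).poly j = s.poly j := fun j hj => by
    simp [Store.poly, hR j hj]
  refine ⟨⟨hI.store.setPoly ?_, hI.frame.congr le_rfl fun k hk =>
    hR k (Finset.mem_union_left _ hk)⟩, hI.deg_gt, fun k hk => (hI.fresh k hk).setPoly, hI.gt,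
    hI.disj, fun k hk => ?_, fun k hk l hl => ?_, fun k hk j hj hjk hd => ?_⟩
  · rw [(hI.fresh h (Finset.mem_union_left _ hh)).deg]
    exact hp
  · rw [hR' k (Finset.mem_union_right _ hk)]
    exact hI.monic k hk
  · simpa using hI.sig_le k hk l hl
  · rw [Store.hm, Store.hm, hR' k (Finset.mem_union_right _ hk), hR' j hj] at hd
    exact (hI.dead k hk j hj hjk hd).mono (hR k (Finset.mem_union_right _ hk)) (hR j hj)
      (fun u => Store.rewritten_setPoly.mpr) (fun u => Store.rewritten_setPoly.mpr)

lemma erase (h : ℕ) : RedInv o e m s A d (ToDo.erase h) Done :=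
  { hI with
    fresh := fun k hk => hI.fresh k
      (Finset.union_subset_union_left (Finset.erase_subset _ _) hk)
    gt := fun k hk => hI.gt k (Finset.union_subset_union_left (Finset.erase_subset _ _) hk)
    disj := hI.disj.mono_left (Finset.erase_subset _ _)
    sig_le := fun k hk l hl => hI.sig_le k hk l (Finset.mem_of_mem_erase hl) }

lemma moveToDone (hh : h ∈ ToDo) (hmin : ∀ k ∈ ToDo, ¬ Sig.lt o (s.sig k) (s.sig h))
    (hmon : o.leadingCoeff (s.poly h) = 1)
    (hdead : ∀ j ∈ A.G ∪ Done, (s.hm o h ⊔ s.hm o j).degree = d → s.Dead o A.i A.base h j) :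
    RedInv o e m s A d (ToDo.erase h) (insert h Done) := by
  have hsub : ToDo.erase h ∪ insert h Done ⊆ ToDo ∪ Done := by
    intro k hk
    simp only [Finset.mem_union, Finset.mem_erase, Finset.mem_insert] at hk ⊢
    rcases hk with hk | rfl | hk
    · exact Or.inl hk.2
    · exact Or.inl hh
    · exact Or.inr hk
  refine ⟨hI.toHeadInv, hI.deg_gt, fun k hk => hI.fresh k (hsub hk),
    fun k hk => hI.gt k (hsub hk), ?_, fun k hk => ?_, fun k hk l hl => ?_,
    fun k hk j hj hjk hd => ?_⟩
  · rw [Finset.disjoint_insert_right]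
    exact ⟨Finset.notMem_erase _ _, hI.disj.mono_left (Finset.erase_subset _ _)⟩
  · rcases Finset.mem_insert.mp hk with rfl | hk
    · exact hmon
    · exact hI.monic k hk
  · rcases Finset.mem_insert.mp hk with rfl | hk
    · exact hmin l (Finset.mem_of_mem_erase hl)
    · exact hI.sig_le k hk l (Finset.mem_of_mem_erase hl)
  -- For two elements of `Done`, the pair was settled when the later one entered; `Dead.symm` covers
  -- the opposite order.
  · have hj' : j = h ∨ j ∈ A.G ∪ Done := by
      simpa [or_left_comm] using hj
    rcases Finset.mem_insert.mp hk with rfl | hkD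
    · exact hdead j (hj'.resolve_left hjk) hd
    · rcases hj' with rfl | hj'
      · rw [sup_comm] at hd
        exact (hdead k (Finset.mem_union_right _ hkD) hd).symm
      · exact hI.dead k hkD j hj' hjk hd

/-- If `r_h` has no reductor, then all its pairs of degree `d` are discarded. -/
lemma dead_of_no_reductor (hh : h ∈ ToDo) (hq : IsNormalForm o A.base (s.poly h) q)
    (hq0 : q ≠ 0) (hnone : ∀ j, ¬ s.IsReductor o A.base (A.G ∪ Done) h q j)
    (hp : o.degree p = o.degree q) (hj : j ∈ A.G ∪ Done)
    (hd : ((s.setPoly h p).hm o h ⊔ (s.setPoly h p).hm o j).degree = d) :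
    (s.setPoly h p).Dead o A.i A.base h j := by
  have hf := hI.fresh h (Finset.mem_union_left _ hh)
  have hjh := hI.ne_of_mem_toDo hh hj
  have hqd := degree_hm (o := o) (hI.isHomogeneous_normalForm hh hq) hq0
  have e1 : (s.setPoly h p).hm o h = o.degree q := by simp [Store.hm, hp]
  have e2 : (s.setPoly h p).hm o j = s.hm o j := by
    simp [Store.hm, Store.poly_setPoly_of_ne hjh]
  unfold Store.Dead
  simp only [Store.sig_setPoly, Store.rewritten_setPoly, e1, e2] at hd ⊢
  -- The lcm has degree d, just like the head monomial of `q`, so they coincide and `r_j` satisfies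
  -- (a).
  have hsup : o.degree q = o.degree q ⊔ s.hm o j :=
    eq_of_le_of_degree_eq le_sup_left (hqd.trans hd.symm)
  have hle : s.hm o j ≤ o.degree q := hsup ▸ le_sup_right
  rw [← hsup, tsub_self]
  refine ⟨hf.idx, ?_, ?_⟩
  · by_contra hne
    have hlt := lt_of_le_of_ne (hI.idx_ge hj) (Ne.symm hne)
    -- An element of `G` with index greater than `A.i` lies in the base of φ, so its head monomial
    -- cannot divide that of the normal form `q`.
    rcases Finset.mem_union.mp hj with hjG | hjD
    · refine hq.not_degree_le hq0 (hI.frame.base j hjG hlt) ?_ hle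
      intro h0
      simpa [h0] using hI.leadingCoeff_eq_one hj
    · exact hne (hI.fresh j (Finset.mem_union_right _ hjD)).idx
  · by_contra hcon
    push Not at hcon
    obtain ⟨-, h2, h3, h4⟩ := hcon
    -- Only (d) can still fail. Then `r_h`, with multiplier `v = 0`, and the multiple of `r_j` share
    -- a signature, so one of them is rewritable.
    refine hnone j ⟨hj, hle, h2, h4, fun hsig => ?_⟩
    rcases hI.store.rewritten_or_rewritten (v := 0) hf.gt hf.le hjh
      (by rw [hsig]; simp [Sig.mul]) with h | h
    · exact h4 h
    · exact h3 h

lemma done (hh : h ∈ ToDo) (hmin : ∀ k ∈ ToDo, ¬ Sig.lt o (s.sig k) (s.sig h))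
    (hq : IsNormalForm o A.base (s.poly h) q) (hq0 : q ≠ 0)
    (hnone : ∀ j, ¬ s.IsReductor o A.base (A.G ∪ Done) h q j) :
    RedInv o e m (s.setPoly h (C (o.leadingCoeff q)⁻¹ * q)) A d (ToDo.erase h)
      (insert h Done) := by
  refine (hI.setPoly hh ((hI.isHomogeneous_normalForm hh hq).C_mul _)).moveToDone hh ?_ ?_ ?_
  · simpa using hmin
  · rw [Store.poly_setPoly_self, leadingCoeff_C_inv_mul hq0]
  · exact fun j hj hd => hI.dead_of_no_reductor hh hq hq0 hnone (degree_C_inv_mul hq0) hj hd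

lemma safe (hh : h ∈ ToDo) (hq : IsNormalForm o A.base (s.poly h) q) (hq0 : q ≠ 0)
    (hj : s.IsReductor o A.base (A.G ∪ Done) h q j) :
    RedInv o e m
      (s.setPoly h (q - monomial (o.degree q - s.hm o j) (o.leadingCoeff q) * s.poly j))
      A d ToDo Done := by
  have hqh := hI.isHomogeneous_normalForm hh hq
  refine hI.setPoly hh (hqh.sub ?_)
  rw [← degree_hm (o := o) hqh hq0]
  exact hI.isHomogeneous_mul hj.1 (tsub_add_cancel_of_le hj.2.1) _

/-- A new rule can only make more multiples of the old labeled polynomials rewritable, so dead pairs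
stay dead. The condition `hsig` keeps `ToDo` from falling below `Done`. -/
lemma push (hi : S.idx = A.i) (hd : S.deg e = d) (hp : p.IsHomogeneous d)
    (hsig : ∀ k ∈ Done, ¬ Sig.lt o S (s.sig k)) :
    RedInv o e m (s.push S p) A d (insert (s.N + 1) ToDo) Done := by
  have hne : ∀ j ∈ A.G ∪ Done, j ≠ s.N + 1 := fun j hj => by have := hI.le_N hj; omega
  have hne' : ∀ j ∈ ToDo ∪ Done, j ≠ s.N + 1 := fun j hj => by
    have := (hI.fresh j hj).le; omega
  have hR' : ∀ j ∈ A.G ∪ Done, (s.push S p).poly j = s.poly j := fun j hj =>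
    Store.poly_push_of_ne (hne j hj)
  refine ⟨⟨hI.store.push (hd ▸ hp), hI.frame.push⟩, hI.deg_gt, fun k hk => ?_,
    fun k hk g hg => ?_, ?_, fun k hk => ?_, fun k hk l hl => ?_, fun k hk j hj hjk hd => ?_⟩
  · rw [Finset.insert_union] at hk
    rcases Finset.mem_insert.mp hk with rfl | hk
    · exact fresh_push_self hI.store.le_N hi hd
    · exact (hI.fresh k hk).push
  · rw [Finset.insert_union] at hk
    rcases Finset.mem_insert.mp hk with rfl | hk
    · exact Nat.lt_succ_of_le (hI.frame.le g hg)
    · exact hI.gt k hk g hg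
  · rw [Finset.disjoint_insert_left]
    exact ⟨fun hN => hne _ (Finset.mem_union_right _ hN) rfl, hI.disj⟩
  · rw [hR' k (Finset.mem_union_right _ hk)]
    exact hI.monic k hk
  · rw [Store.sig_push_of_ne (hne k (Finset.mem_union_right _ hk))]
    rcases Finset.mem_insert.mp hl with rfl | hl
    · rw [Store.sig_push_self]
      exact hsig k hk
    · rw [Store.sig_push_of_ne (hne' l (Finset.mem_union_left _ hl))]
      exact hI.sig_le k hk l hl
  · have hk' := Finset.mem_union_right A.G hk
    rw [Store.hm, Store.hm, hR' k hk', hR' j hj] at hd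
    exact (hI.dead k hk j hj hjk hd).mono (Store.R_push_of_ne (hne k hk'))
      (Store.R_push_of_ne (hne j hj)) (fun u hu => hu.push (hne k hk'))
      (fun u hu => hu.push (hne j hj))

/-- A reductor whose multiple does not have a smaller signature belongs to the current call. -/
lemma idx_reductor (hh : h ∈ ToDo) (hj : j ∈ A.G ∪ Done) {u : Fin n →₀ ℕ}
    (hlt : ¬ Sig.lt o ((s.sig j).mul u) (s.sig h)) : (s.sig j).idx = A.i := by
  refine le_antisymm (not_lt.mp fun h1 => hlt (Or.inl ?_)) (hI.idx_ge hj)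
  rw [(hI.fresh h (Finset.mem_union_left _ hh)).idx]
  exact h1

lemma new (hh : h ∈ ToDo) (hq : IsNormalForm o A.base (s.poly h) q) (hq0 : q ≠ 0)
    (hj : s.IsReductor o A.base (A.G ∪ Done) h q j)
    (hlt : ¬ Sig.lt o ((s.sig j).mul (o.degree q - s.hm o j)) (s.sig h)) :
    RedInv o e m
      ((s.setPoly h q).push ((s.sig j).mul (o.degree q - s.hm o j))
        (monomial (o.degree q - s.hm o j) (o.leadingCoeff q) * s.poly j - q))
      A d (insert (s.N + 1) ToDo) Done := by
  have hqh := hI.isHomogeneous_normalForm hh hq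
  have hqd := degree_hm (o := o) hqh hq0
  have hu := tsub_add_cancel_of_le hj.2.1
  have hidx := hI.idx_reductor hh hj.1 hlt
  refine (hI.setPoly hh hqh).push hidx ?_ (.sub ?_ hqh) fun k hk => ?_
  · rw [hI.deg_mul_sig hj.1 hu, hqd]
  · rw [← hqd]
    exact hI.isHomogeneous_mul hj.1 hu _
  · have hh' := (hI.fresh h (Finset.mem_union_left _ hh)).idx
    have hk' := (hI.fresh k (Finset.mem_union_right _ hk)).idx
    -- All three signatures have index `A.i`, so their monomials can be chained: `Done` ≤ signature
    -- of `r_h` ≤ new signature.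
    have h1 := hI.sig_le k hk h hh
    rw [Store.sig_setPoly]
    rw [Sig.lt_iff_of_idx_eq (S := (s.sig j).mul _) (hidx.trans hh'.symm), not_lt] at hlt
    rw [Sig.lt_iff_of_idx_eq (hh'.trans hk'.symm), not_lt] at h1
    rw [Sig.lt_iff_of_idx_eq (S := (s.sig j).mul _) (hidx.trans hk'.symm), not_lt]
    exact h1.trans hlt

end RedInv

lemma RedInv.insInv (hI : RedInv o e m s A d ∅ Done) : InsInv o e m s A d Done where
  toHeadInv := hI.toHeadInv
  deg_ge c hc := (hI.deg_gt c hc).le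
  skipped c hc hd := ((hI.deg_gt c hc).ne' hd).elim
  fresh := by simpa using hI.fresh
  disj k hk hG := (hI.gt k (Finset.mem_union_right _ hk) k hG).false
  monic := hI.monic
  dead := hI.dead

/-- The head monomial of `r_k` has degree d and divides the lcm of each new pair. So no new pair has
degree below d, and those of degree d are dead, hence skipped by Spol. -/
lemma InsInv.add (hI : InsInv o e m s A d Rd) (hk : k ∈ Rd) :
    InsInv o e m s
      { A with
        P := A.P ∪ A.G.biUnion (fun l => s.critPair o A.i A.base k l)
        G := insert k A.G } d (Rd.erase k) := by
  have hf := hI.fresh k hk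
  have hki : A.i ≤ k := hI.store.le_m.trans hf.gt.le
  have hidx : ∀ l ∈ insert k A.G, A.i ≤ (s.sig l).idx :=
    Finset.forall_mem_insert _ _ _ |>.mpr ⟨hf.idx.ge, hI.frame.idx⟩
  have hhm : (s.hm o k).degree = d := by
    rw [hI.store.degree_hm hki hf.le (hI.monic k hk), hf.deg]
  have hsub : insert k A.G ∪ Rd.erase k ⊆ A.G ∪ Rd := by
    intro l hl
    simp only [Finset.mem_union, Finset.mem_erase, Finset.mem_insert] at hl ⊢
    rcases hl with (rfl | hl) | hl
    · exact Or.inr hk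
    · exact Or.inl hl
    · exact Or.inr hl.2
  refine ⟨⟨hI.store, ⟨?_, ?_, ?_, hidx, ?_, hI.frame.hom, fun c hc => ?_⟩⟩, fun c hc => ?_,
    fun c hc hd => ?_, fun l hl => hI.fresh l (Finset.mem_of_mem_erase hl), fun l hl hG => ?_,
    fun l hl => hI.monic l (Finset.mem_of_mem_erase hl),
    fun l hl j hj => hI.dead l (Finset.mem_of_mem_erase hl) j (hsub hj)⟩
  · exact Finset.forall_mem_insert _ _ _ |>.mpr ⟨hki, hI.frame.ge⟩
  · exact Finset.forall_mem_insert _ _ _ |>.mpr ⟨hf.le, hI.frame.le⟩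
  · exact Finset.forall_mem_insert _ _ _ |>.mpr ⟨hI.monic k hk, hI.frame.monic⟩
  · exact Finset.forall_mem_insert _ _ _ |>.mpr ⟨fun h => (h.ne' hf.idx).elim, hI.frame.base⟩
  · rcases Finset.mem_union.mp hc with hc | hc
    · exact (hI.frame.pairs c hc).mono (Finset.subset_insert _ _)
    · obtain ⟨l, hl, hc⟩ := Finset.mem_biUnion.mp hc
      exact Store.validPair_of_mem_critPair hc (Finset.mem_insert_self _ _)
        (Finset.mem_insert_of_mem hl) hidx
  · rcases Finset.mem_union.mp hc with hc | hc
    · exact hI.deg_ge c hc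
    · obtain ⟨l, hl, hc⟩ := Finset.mem_biUnion.mp hc
      rw [Store.deg_of_mem_critPair hc, ← hhm]
      exact Finsupp.degree_mono le_sup_left
  · rcases Finset.mem_union.mp hc with hc | hc
    · exact hI.skipped c hc hd
    · obtain ⟨l, hl, hc⟩ := Finset.mem_biUnion.mp hc
      rw [Store.deg_of_mem_critPair hc] at hd
      refine (hI.dead k hk l (Finset.mem_union_left _ hl) ?_ hd).skipped hc
      rintro rfl
      exact hI.disj l hk hl
  · rcases Finset.mem_insert.mp hG with rfl | hG
    · exact Finset.notMem_erase _ _ hl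
    · exact hI.disj l (Finset.mem_of_mem_erase hl) hG

end StateInvariants

/-! ### Termination of one iteration. -/

section Termination

variable {n : ℕ} {K : Type*} [Field K] {o : MonomialOrder (Fin n)}
  {f : ℕ → MvPolynomial (Fin n) K} {p q : MvPolynomial (Fin n) K} {s : Store n K}
  {A : Frame n K} {S : Sig n} {e : ℕ → ℕ} {m i d h j k : ℕ} {Pd : Finset (CritPair n)}
  {F ToDo Done Rd : Finset ℕ} {Q Q' : State n K → Prop} {x : State n K}

lemma Inevitable.trans (h : Inevitable o f Q x) (hQ : ∀ y, Q y → Inevitable o f Q' y) :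
    Inevitable o f Q' x := by
  induction h with
  | now x hx => exact hQ x hx
  | later x hne _ ih => exact .later x hne ih

/-- The number of signatures of degree `d` for which no rule has been added since the elements
of `G` were created. -/
noncomputable def numFreeSigs (e : ℕ → ℕ) (d : ℕ) (A : Frame n K) (s : Store n K) : ℕ :=
  {t : Fin n →₀ ℕ | Sig.deg e ⟨t, A.i⟩ = d ∧
    ∀ ρ ∈ s.Rule A.i, ρ.1 = t → ∃ g ∈ A.G, ρ.2 ≤ g}.ncard

lemma finite_sig_deg_eq (e : ℕ → ℕ) (d i : ℕ) :
    {t : Fin n →₀ ℕ | Sig.deg e ⟨t, i⟩ = d}.Finite :=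
  (Finsupp.finite_of_degree_le d).subset fun t ht => by
    have : t.degree + e i = d := ht
    exact (Nat.le_add_right _ _).trans this.le

/-- `Reduction` never adds two labeled polynomials with the same signature. -/
lemma RedInv.numFreeSigs_push_lt (hI : RedInv o e m s A d ToDo Done) (hh : h ∈ ToDo)
    (hq : IsNormalForm o A.base (s.poly h) q) (hq0 : q ≠ 0)
    (hj : s.IsReductor o A.base (A.G ∪ Done) h q j)
    (hlt : ¬ Sig.lt o ((s.sig j).mul (o.degree q - s.hm o j)) (s.sig h)) :
    numFreeSigs e d A ((s.setPoly h q).push ((s.sig j).mul (o.degree q - s.hm o j)) p) <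
      numFreeSigs e d A s := by
  have hidx := hI.idx_reductor hh hj.1 hlt
  have hu := tsub_add_cancel_of_le hj.2.1
  have hqd := degree_hm (o := o) (hI.isHomogeneous_normalForm hh hq) hq0
  have hdeg := hI.deg_mul_sig hj.1 hu
  refine Set.ncard_lt_ncard ⟨fun t ht => ⟨ht.1, fun ρ hρ => ht.2 ρ (Store.Rule_subset_push hρ)⟩,
    fun hsub => ?_⟩ ((finite_sig_deg_eq e d A.i).subset fun t ht => ht.1)
  -- The signature lost is that of the new labeled polynomial. It was free before: by
  -- non-rewritability no rule for it is newer than `r_j`.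
  obtain ⟨-, hfree⟩ := @hsub (o.degree q - s.hm o j + (s.sig j).mon)
    ⟨by rw [← hqd, ← hdeg, ← hidx]; rfl, fun ρ hρ hρt => by
      have hle : ρ.2 ≤ j := hI.store.rule_le_of_not_rewritten hj.2.2.2.1 (hidx ▸ hρ) hρt.le
      rcases Finset.mem_union.mp hj.1 with hG | hD
      · exact ⟨j, hG, hle⟩
      -- A reductor from `Done` has a head monomial of degree d, so its multiplier is 1. Minimality
      -- of signatures in `Done` then forces equality with the signature of `r_h`, against (d).
      · exfalso
        have hf := hI.fresh j (Finset.mem_union_right _ hD)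
        have hjd : (s.hm o j).degree = d := by
          rw [hI.store.degree_hm (hI.index_le hj.1) (hI.le_N hj.1) (hI.monic j hD), hf.deg]
        have h0 : o.degree q - s.hm o j = 0 := by
          rw [eq_of_le_of_degree_eq hj.2.1 (hjd.trans hqd.symm), tsub_self]
        have h1 : (s.sig j).mul (o.degree q - s.hm o j) = s.sig j := by simp [h0, Sig.mul]
        refine hj.2.2.2.2 (h1.trans (Sig.eq_of_not_lt (o := o) ?_ (h1 ▸ hlt)
          (hI.sig_le j hD h hh)))
        rw [hidx, (hI.fresh h (Finset.mem_union_left _ hh)).idx]⟩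
  -- Afterwards it is not free: the new rule has position `s.N + 1`, beyond every element of `G`.
  obtain ⟨g, hg, hle⟩ := hfree (o.degree q - s.hm o j + (s.sig j).mon, s.N + 1)
    (by simp [Store.Rule_push, Sig.mul, hidx]) rfl
  have := hI.frame.le g hg
  simp only at hle
  omega

/-- The number of steps of `Reduction` until the next labeled polynomial is added is bounded by
this number. -/
noncomputable def totalRank (o : MonomialOrder (Fin n)) (d : ℕ) (s : Store n K)
    (ToDo : Finset ℕ) : ℕ :=
  ∑ h ∈ ToDo, (rank o d (s.poly h) + 1)

lemma totalRank_erase_lt (hh : h ∈ ToDo) :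
    totalRank o d (s.setPoly h p) (ToDo.erase h) < totalRank o d s ToDo := by
  unfold totalRank
  rw [← Finset.add_sum_erase _ _ hh,
    Finset.sum_congr rfl fun k hk => by rw [Store.poly_setPoly_of_ne (Finset.ne_of_mem_erase hk)]]
  omega

lemma totalRank_setPoly_lt (hh : h ∈ ToDo) (hp : rank o d p < rank o d (s.poly h)) :
    totalRank o d (s.setPoly h p) ToDo < totalRank o d s ToDo := by
  unfold totalRank
  rw [← Finset.add_sum_erase _ _ hh, ← Finset.add_sum_erase (a := h) _ _ hh,
    Finset.sum_congr rfl fun k hk => by rw [Store.poly_setPoly_of_ne (Finset.ne_of_mem_erase hk)],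
    Store.poly_setPoly_self]
  omega

/-- `Reduction` can always proceed. -/
lemma RedInv.exists_step (hI : RedInv o e m s A d ToDo Done) :
    ∃ y, Step o f (.red s A d ToDo Done) y := by
  rcases ToDo.eq_empty_or_nonempty with rfl | hne
  · exact ⟨_, .redRet s A d Done⟩
  obtain ⟨h, hh, hmin⟩ := ToDo.exists_min_image (fun k => o.toSyn (s.sig k).mon) hne
  have hmin' : ∀ k ∈ ToDo, ¬ Sig.lt o (s.sig k) (s.sig h) := fun k hk => by
    rw [Sig.lt_iff_of_idx_eq, not_lt]
    · exact hmin k hk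
    · rw [(hI.fresh k (Finset.mem_union_left _ hk)).idx,
        (hI.fresh h (Finset.mem_union_left _ hh)).idx]
  obtain ⟨q, hq⟩ := exists_isNormalForm o A.base (s.poly h)
  by_cases hq0 : q = 0
  · exact ⟨_, .redZero s A d ToDo Done h hh hmin' (hq0 ▸ hq)⟩
  by_cases hnone : ∀ j, ¬ s.IsReductor o A.base (A.G ∪ Done) h q j
  · exact ⟨_, .redDone s A d ToDo Done h q hh hmin' hq hq0 hnone⟩
  push Not at hnone
  obtain ⟨j, hj⟩ := hnone
  by_cases hlt : Sig.lt o ((s.sig j).mul (o.degree q - s.hm o j)) (s.sig h)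
  · exact ⟨_, .redSafe s A d ToDo Done h j q hh hmin' hq hq0 hj hlt⟩
  · exact ⟨_, .redNew s A d ToDo Done h j q hh hmin' hq hq0 hj hlt⟩

/-- Every call to `Reduction` terminates. -/
lemma RedInv.inevitable (hI : RedInv o e m s A d ToDo Done) :
    Inevitable o f (fun z => ∃ s' Rd, z = .ins s' A d Rd) (.red s A d ToDo Done) := by
  -- Lexicographic induction: a new labeled polynomial may raise `totalRank` but consumes a free
  -- signature. The other reduction steps add no rule, so they keep the first component and lower
  -- the second.
  induction ha : numFreeSigs e d A s using Nat.strong_induction_on generalizing s ToDo Done with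
  | _ a iha =>
  induction hb : totalRank o d s ToDo using Nat.strong_induction_on
    generalizing s ToDo Done with
  | _ b ihb =>
  refine .later _ hI.exists_step fun y hy => ?_
  cases hy with
  | redZero _ _ _ _ _ h hh hmin hq =>
    exact ihb _ (hb ▸ totalRank_erase_lt hh)
      ((hI.setPoly hh (isHomogeneous_zero _ _ _)).erase h) ha rfl
  | redDone _ _ _ _ _ h q hh hmin hq hq0 hnone =>
    exact ihb _ (hb ▸ totalRank_erase_lt hh) (hI.done hh hmin hq hq0 hnone) ha rfl
  | redSafe _ _ _ _ _ h j q hh hmin hq hq0 hj hlt =>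
    exact ihb _ (hb ▸ totalRank_setPoly_lt hh (rank_topReduction_lt hI.frame.hom
      (hI.isHomogeneous hh) hq hq0 (hI.leadingCoeff_eq_one hj.1) hj.2.1))
      (hI.safe hh hq hq0 hj) ha rfl
  | redNew _ _ _ _ _ h j q hh hmin hq hq0 hj hlt =>
    exact iha _ (ha ▸ hI.numFreeSigs_push_lt hh hq hq0 hj hlt) (hI.new hh hq hq0 hj hlt) rfl
  | redRet => exact .now _ ⟨_, _, rfl⟩

/-- Every step consumes a pair of `Pd`. The target carries `RedInv` so that the termination of
Reduction can be appended by `Inevitable.trans`. -/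
lemma SpolInv.inevitable (hI : SpolInv o e m s A d Pd F) :
    Inevitable o f (fun z => ∃ s' F', z = .red s' A d F' ∅ ∧ RedInv o e m s' A d F' ∅)
      (.spol s A d Pd F) := by
  induction hc : Pd.card using Nat.strong_induction_on generalizing s Pd F with
  | _ a ih =>
  refine .later _ ?_ fun y hy => ?_
  · rcases Pd.eq_empty_or_nonempty with rfl | ⟨c, hc⟩
    · exact ⟨_, .spolRet s A d F⟩
    · by_cases hr : s.Rewritten c.u₁ c.k₁ ∨ s.Rewritten c.u₂ c.k₂
      · exact ⟨_, .spolSkip s A d Pd F c hc hr⟩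
      · exact ⟨_, .spolAdd s A d Pd F c hc (not_or.mp hr)⟩
  · cases hy with
    | spolSkip _ _ _ _ _ c hc' hr =>
      exact ih _ (hc ▸ Finset.card_erase_lt_of_mem hc') (hI.erase c) rfl
    | spolAdd _ _ _ _ _ c hc' hr =>
      exact ih _ (hc ▸ Finset.card_erase_lt_of_mem hc') (hI.add hc') rfl
    | spolRet => exact .now _ ⟨_, _, rfl, hI.redInv⟩

lemma ins_inevitable (s : Store n K) (A : Frame n K) (d : ℕ) (Rd : Finset ℕ) :
    Inevitable o f (AtHead A.i) (.ins s A d Rd) := by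
  induction hc : Rd.card using Nat.strong_induction_on generalizing A Rd with
  | _ a ih =>
  refine .later _ ?_ fun y hy => ?_
  · rcases Rd.eq_empty_or_nonempty with rfl | ⟨r, hr⟩
    · exact ⟨_, .insRet s A d⟩
    · exact ⟨_, .insAdd s A d Rd r hr⟩
  · cases hy with
    | insAdd _ _ _ _ r hr =>
      exact ih _ (hc ▸ Finset.card_erase_lt_of_mem hr)
        { A with
          P := A.P ∪ A.G.biUnion (fun k => s.critPair o A.i A.base r k)
          G := insert r A.G } _ rfl
    | insRet => exact .now _ ⟨_, _, rfl, rfl⟩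

/-- Every iteration of the **while** cycle terminates. -/
lemma HeadInv.inevitable (hI : HeadInv o e m s A) (hd : IsFirstDegree A.P d) {y : State n K}
    (hy : Step o f (.head s A) y) : Inevitable o f (AtHead A.i) y := by
  obtain ⟨⟨c, hc, -⟩, -⟩ := hd
  cases hy with
  | ret _ _ hP => simp [hP] at hc
  | retOne _ _ hP => simp [hP] at hc
  | iter _ _ d' hd' =>
    refine (hI.spolInv hd').inevitable.trans ?_
    rintro _ ⟨s', F', rfl, hR⟩
    refine hR.inevitable.trans ?_
    rintro _ ⟨s'', Rd, rfl⟩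
    exact ins_inevitable s'' { A with P := A.P.filter (fun p => p.deg ≠ d') } d' Rd

end Termination

/-! ### Invariants along executions, and growth of the degree. -/

section Reachability

variable {n : ℕ} {K : Type*} [Field K] {o : MonomialOrder (Fin n)}
  {f : ℕ → MvPolynomial (Fin n) K} {s : Store n K} {A : Frame n K} {e : ℕ → ℕ}
  {m i d d' : ℕ} {G : Finset ℕ} {x y z : State n K}

/-- The invariant of an iteration with index `i` and degree `d`, including its end. -/
def IterInv (o : MonomialOrder (Fin n)) (e : ℕ → ℕ) (m i d : ℕ) : State n K → Prop
  | .spol s A d' Pd F => A.i = i ∧ d' = d ∧ SpolInv o e m s A d Pd F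
  | .red s A d' ToDo Done => A.i = i ∧ d' = d ∧ RedInv o e m s A d ToDo Done
  | .ins s A d' Rd => A.i = i ∧ d' = d ∧ InsInv o e m s A d Rd
  | .head s A => A.i = i ∧ InsInv o e m s A d ∅
  | _ => False

/-- What survives at the final test is `InsInv` with nothing left to insert: all remaining pairs
have degree at least d, and those of degree d will be skipped. -/
lemma IterInv.step (hI : IterInv o e m i d x) (hx : ∀ i', ¬ AtHead i' x)
    (hs : Step o f x y) : IterInv o e m i d y := by
  cases hs with
  | call => exact hI.elim
  | finish => exact hI.elim
  | ret s A => exact (hx _ ⟨s, A, rfl, rfl⟩).elim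
  | retOne s A => exact (hx _ ⟨s, A, rfl, rfl⟩).elim
  | iter s A => exact (hx _ ⟨s, A, rfl, rfl⟩).elim
  | spolSkip => obtain ⟨rfl, rfl, hI⟩ := hI; exact ⟨rfl, rfl, hI.erase _⟩
  | spolAdd _ _ _ _ _ _ hp => obtain ⟨rfl, rfl, hI⟩ := hI; exact ⟨rfl, rfl, hI.add hp⟩
  | spolRet => obtain ⟨rfl, rfl, hI⟩ := hI; exact ⟨rfl, rfl, hI.redInv⟩
  | redZero _ _ _ _ _ _ hh =>
    obtain ⟨rfl, rfl, hI⟩ := hI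
    exact ⟨rfl, rfl, (hI.setPoly hh (isHomogeneous_zero _ _ _)).erase _⟩
  | redDone _ _ _ _ _ _ _ hh hmin hq hq0 hnone =>
    obtain ⟨rfl, rfl, hI⟩ := hI; exact ⟨rfl, rfl, hI.done hh hmin hq hq0 hnone⟩
  | redSafe _ _ _ _ _ _ _ _ hh hmin hq hq0 hj =>
    obtain ⟨rfl, rfl, hI⟩ := hI; exact ⟨rfl, rfl, hI.safe hh hq hq0 hj⟩
  | redNew _ _ _ _ _ _ _ _ hh hmin hq hq0 hj hlt =>
    obtain ⟨rfl, rfl, hI⟩ := hI; exact ⟨rfl, rfl, hI.new hh hq hq0 hj hlt⟩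
  | redRet => obtain ⟨rfl, rfl, hI⟩ := hI; exact ⟨rfl, rfl, hI.insInv⟩
  | insAdd _ _ _ _ _ hr => obtain ⟨rfl, rfl, hI⟩ := hI; exact ⟨rfl, rfl, hI.add hr⟩
  | insRet => obtain ⟨rfl, rfl, hI⟩ := hI; exact ⟨rfl, hI⟩

/-- The invariant of the whole execution. -/
def Inv (o : MonomialOrder (Fin n)) (e : ℕ → ℕ) (m : ℕ) : State n K → Prop
  | .outer s i G => ∃ A : Frame n K, A.i = i ∧ A.G = G ∧ HeadInv o e m s A
  | .head s A => HeadInv o e m s A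
  | .halted _ => True
  | x => ∃ i d, IterInv o e m i d x

lemma IterInv.inv (hI : IterInv o e m i d x) : Inv o e m x := by
  cases x with
  | outer => exact hI.elim
  | halted => exact hI.elim
  | head => exact hI.2.toHeadInv
  | spol => exact ⟨i, d, hI⟩
  | red => exact ⟨i, d, hI⟩
  | ins => exact ⟨i, d, hI⟩

/-- Position `i` is the only one for which homogeneity was not known before. Input polynomials have
no rules, so the clauses about rules are unaffected. -/
lemma StoreInv.setInput (hs : StoreInv e m k s) (hi : i ≤ m) (hik : k ≤ i + 1)
    {g : MvPolynomial (Fin n) K} (hg : g.IsHomogeneous (e i)) :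
    StoreInv e m i (s.setInput o i g) where
  le_m := hi
  le_N := hs.le_N
  hom l h1 h2 := by
    by_cases hl : l = i
    · subst hl
      simpa [Store.setInput, Store.poly, Store.sig, Sig.deg] using hg.C_mul _
    · simpa [Store.setInput, Store.poly, Store.sig, hl] using hs.hom l (by omega) h2
  sorted := hs.sorted
  rule_le := hs.rule_le
  rule_mem l h1 h2 := by
    have hl : l ≠ i := by omega
    simpa [Store.setInput, Store.sig, hl] using hs.rule_mem l h1 h2

/-- The old elements have index at least `i + 1`, and their polynomials form the new base, so every
element of index above `i` lies in the base. -/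
lemma HeadInv.inv_enter (hI : HeadInv o e m s A) (hA : A.i = i + 1)
    {g : MvPolynomial (Fin n) K} (hg0 : g ≠ 0) (hg : g.IsHomogeneous (e i)) :
    Inv o e m (enter o s i g A.G) := by
  have him : i ≤ m := by have := hI.store.le_m; omega
  have hS : StoreInv e m i (s.setInput o i g) := hI.store.setInput him hA.le hg
  have hik : ∀ k ∈ A.G, i ≤ k := fun k hk => by have := hI.frame.ge k hk; omega
  have hne : ∀ k ∈ A.G, k ≠ i := fun k hk => by have := hI.frame.ge k hk; omega
  have hR : ∀ k ∈ A.G, (s.setInput o i g).R k = s.R k := fun k hk => by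
    simp [Store.setInput, hne k hk]
  have hsig : ∀ k ∈ A.G, (s.setInput o i g).sig k = s.sig k := fun k hk => by
    simp [Store.sig, hR k hk]
  have hpoly : ∀ k ∈ A.G, (s.setInput o i g).poly k = s.poly k := fun k hk => by
    simp [Store.poly, hR k hk]
  have hsigi : (s.setInput o i g).sig i = ⟨0, i⟩ := by simp [Store.setInput, Store.sig]
  have hpolyi : (s.setInput o i g).poly i = C (o.leadingCoeff g)⁻¹ * g := by
    simp [Store.setInput, Store.poly]
  have hidx : ∀ k ∈ A.G, i < ((s.setInput o i g).sig k).idx := fun k hk => by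
    have := hI.frame.idx k hk
    rw [hsig k hk]
    omega
  have hidx' : ∀ k ∈ insert i A.G, i ≤ ((s.setInput o i g).sig k).idx :=
    Finset.forall_mem_insert _ _ _ |>.mpr ⟨by rw [hsigi], fun k hk => (hidx k hk).le⟩
  refine ⟨hS, ⟨?_, ?_, ?_, hidx', ?_, ?_, fun c hc => ?_⟩⟩
  · exact Finset.forall_mem_insert _ _ _ |>.mpr ⟨le_rfl, hik⟩
  · exact Finset.forall_mem_insert _ _ _ |>.mpr ⟨him.trans hS.le_N, hI.frame.le⟩
  · refine Finset.forall_mem_insert _ _ _ |>.mpr ⟨?_, fun k hk => ?_⟩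
    · rw [hpolyi, leadingCoeff_C_inv_mul hg0]
    · rw [hpoly k hk, hI.frame.monic k hk]
  · refine Finset.forall_mem_insert _ _ _ |>.mpr ⟨fun h => ?_, fun k hk _ => ⟨k, hk, rfl⟩⟩
    rw [hsigi] at h
    exact (lt_irrefl _ h).elim
  · rintro _ ⟨k, hk, rfl⟩
    exact ⟨_, hS.hom k (hik k hk) (hI.frame.le k hk)⟩
  · obtain ⟨k, hk, hc⟩ := Finset.mem_biUnion.mp hc
    exact Store.validPair_of_mem_critPair hc (Finset.mem_insert_self _ _)
      (Finset.mem_insert_of_mem hk) hidx'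

lemma Inv.step (hf0 : ∀ i, 1 ≤ i → i ≤ m → f i ≠ 0)
    (hf : ∀ i, 1 ≤ i → i ≤ m → (f i).IsHomogeneous (e i))
    (hI : Inv o e m x) (hs : Step o f x y) : Inv o e m y := by
  have key : (∃ i d, IterInv o e m i d x) → (∀ i', ¬ AtHead i' x) → Inv o e m y := by
    rintro ⟨i, d, hI⟩ hx
    exact (hI.step hx hs).inv
  have hhead : ∀ {x : State n K}, (∀ s A, x ≠ .head s A) → ∀ i', ¬ AtHead i' x := by
    rintro x hx i' ⟨s, A, h, -⟩
    exact hx s A h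
  cases x with
  | outer s i G =>
    obtain ⟨A, rfl, rfl, hI⟩ := hI
    generalize hi : A.i = i at hs
    cases hs with
    | call _ i _ h1 =>
      have := hI.store.le_m
      exact hI.inv_enter hi (hf0 i h1 (by omega)) (hf i h1 (by omega))
    | finish => trivial
  | head s A =>
    cases hs with
    | ret => exact ⟨A, rfl, rfl, hI⟩
    | retOne => trivial
    | iter _ _ d hd =>
      exact IterInv.inv (i := A.i) (d := d) ⟨rfl, rfl, hI.spolInv hd⟩
  | halted => cases hs
  | spol => exact key hI (hhead (by simp))
  | red => exact key hI (hhead (by simp))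
  | ins => exact key hI (hhead (by simp))

lemma inv_start (hm : f m ≠ 0) (hf : (f m).IsHomogeneous (e m)) : Inv o e m (start o m f) := by
  -- No call has computed G_m, so a fictitious frame is supplied. Its base may be empty because
  -- `r_m` has index exactly `m`.
  refine ⟨⟨m, ∅, {m}, ∅⟩, rfl, rfl, ⟨le_rfl, le_rfl, fun k h1 h2 => ?_, by simp [Store.setInput],
    by simp [Store.setInput], fun k h1 h2 => (h1.not_ge h2).elim⟩, ⟨by simp,
    by simp [Store.setInput], ?_, ?_, ?_, by simp, by simp⟩⟩
  · obtain rfl : m = k := le_antisymm h1 h2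
    simpa [Store.setInput, Store.poly, Store.sig, Sig.deg] using hf.C_mul _
  · simpa [Store.setInput, Store.poly] using leadingCoeff_C_inv_mul hm
  · simp [Store.setInput, Store.sig]
  · simp [Store.setInput, Store.sig]

lemma Reachable.inv (hm : 1 ≤ m) (hf0 : ∀ i, 1 ≤ i → i ≤ m → f i ≠ 0)
    (hf : ∀ i, 1 ≤ i → i ≤ m → (f i).IsHomogeneous (e i)) (hx : Reachable o m f x) :
    Inv o e m x := by
  induction hx with
  | refl => exact inv_start (hf0 m hm le_rfl) (hf m hm le_rfl)
  | tail _ hs ih => exact ih.step hf0 hf hs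

/-- A property that is preserved by the steps inside an iteration holds at its end. -/
lemma path_induction {Q : State n K → Prop}
    (hQ : ∀ x y, Q x → (∀ i', ¬ AtHead i' x) → Step o f x y → Q y)
    (h : Relation.ReflTransGen (fun a b => (∀ i', ¬ AtHead i' a) ∧ Step o f a b) x y)
    (hx : Q x) : Q y := by
  induction h with
  | refl => exact hx
  | tail _ hs ih => exact hQ _ _ ih hs.1 hs.2

lemma IsFirstDegree.unique {P : Finset (CritPair n)} (h : IsFirstDegree P d)
    (h' : IsFirstDegree P d') : d = d' := by
  obtain ⟨⟨p, hp, rfl⟩, h2⟩ := h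
  obtain ⟨⟨p', hp', rfl⟩, h2'⟩ := h'
  exact le_antisymm (h2 _ hp') (h2' _ hp)

lemma Iteration.iterInv (hI : Inv o e m x) (h : Iteration o f i x d y) :
    IterInv o e m i d y := by
  obtain ⟨⟨s, A, rfl, rfl, hd⟩, -, z, hz, hpath⟩ := h
  refine path_induction (fun _ _ => IterInv.step) hpath ?_
  cases hz with
  | ret _ _ hP => obtain ⟨⟨c, hc, -⟩, -⟩ := hd; simp [hP] at hc
  | retOne _ _ hP => obtain ⟨⟨c, hc, -⟩, -⟩ := hd; simp [hP] at hc
  | iter _ _ d' hd' =>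
    obtain rfl := hd.unique hd'
    exact ⟨rfl, rfl, HeadInv.spolInv hI hd⟩

/-- In an iteration all pairs of which are discarded by `Spol`, no pair is created. -/
def IdleInv (d : ℕ) : State n K → Prop
  | .spol s A _ Pd F => F = ∅ ∧ (∀ c ∈ Pd, s.Skipped c) ∧ ∀ c ∈ A.P, d < c.deg
  | .red _ A _ ToDo Done => ToDo = ∅ ∧ Done = ∅ ∧ ∀ c ∈ A.P, d < c.deg
  | .ins _ A _ Rd => Rd = ∅ ∧ ∀ c ∈ A.P, d < c.deg
  | .head _ A => ∀ c ∈ A.P, d < c.deg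
  | _ => False

/-- Skipping a pair adds no rule, so the remaining pairs stay skippable; Reduction then receives and
returns the empty set. -/
lemma IdleInv.step (hI : IdleInv d x) (hx : ∀ i', ¬ AtHead i' x) (hs : Step o f x y) :
    IdleInv d y := by
  cases hs with
  | call => exact hI.elim
  | finish => exact hI.elim
  | ret s A => exact (hx _ ⟨s, A, rfl, rfl⟩).elim
  | retOne s A => exact (hx _ ⟨s, A, rfl, rfl⟩).elim
  | iter s A => exact (hx _ ⟨s, A, rfl, rfl⟩).elim
  | spolSkip => exact ⟨hI.1, fun c hc => hI.2.1 c (Finset.mem_of_mem_erase hc), hI.2.2⟩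
  | spolAdd _ _ _ _ _ p hp hr => exact ((not_or.mpr hr) (hI.2.1 p hp)).elim
  | spolRet => exact ⟨hI.1, rfl, hI.2.2⟩
  | redZero _ _ _ _ _ _ hh => simp [hI.1] at hh
  | redDone _ _ _ _ _ _ _ hh => simp [hI.1] at hh
  | redSafe _ _ _ _ _ _ _ _ hh => simp [hI.1] at hh
  | redNew _ _ _ _ _ _ _ _ hh => simp [hI.1] at hh
  | redRet => exact hI.2
  | insAdd _ _ _ _ _ hr => simp [hI.1] at hr
  | insRet => exact hI.2

/-- The same `d` in both hypotheses says that the preceding iteration had this degree too, and that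
one left only skippable pairs of degree d. -/
lemma Iteration.idleInv (hI : IterInv o e m i d x) (h : Iteration o f i x d y) :
    IdleInv d y := by
  obtain ⟨⟨s, A, rfl, rfl, hd⟩, -, z, hz, hpath⟩ := h
  refine path_induction (fun _ _ => IdleInv.step) hpath ?_
  cases hz with
  | ret _ _ hP => obtain ⟨⟨c, hc, -⟩, -⟩ := hd; simp [hP] at hc
  | retOne _ _ hP => obtain ⟨⟨c, hc, -⟩, -⟩ := hd; simp [hP] at hc
  | iter _ _ d' hd' =>
    obtain rfl := hd.unique hd'
    refine ⟨rfl, fun c hc => ?_, (hI.2.spolInv hd).deg_gt⟩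
    obtain ⟨hc, hcd⟩ := Finset.mem_filter.mp hc
    exact hI.2.skipped c hc hcd

/-- The degree increases strictly in any two consecutive iterations. -/
lemma Iteration.lt {x₀ x₁ x₂ : State n K} {d₀ d₁ d₂ : ℕ} (hI : Inv o e m x₀)
    (h₀ : Iteration o f i x₀ d₀ x₁) (h₁ : Iteration o f i x₁ d₁ x₂)
    (h₂ : StartsIteration i x₂ d₂) : d₀ < d₂ := by
  have hI₁ := h₀.iterInv hI
  have hI₂ := h₁.iterInv hI₁.inv
  obtain ⟨s₁, A₁, hx₁, -, ⟨c₁, hc₁, hd₁⟩, -⟩ := h₁.1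
  obtain ⟨s₂, A₂, rfl, -, ⟨c₂, hc₂, rfl⟩, -⟩ := h₂
  have hle : d₀ ≤ d₁ := by
    rw [hx₁] at hI₁
    exact hd₁ ▸ hI₁.2.deg_ge c₁ hc₁
  -- Either the degree already rises in the first step and cannot fall in the second, or it repeats
  -- and the second iteration is idle.
  rcases hle.lt_or_eq with hlt | rfl
  · exact hlt.trans_le (hI₂.2.deg_ge c₂ hc₂)
  · exact h₁.idleInv hI₁ c₂ hc₂

end Reachability

/-! ### Structure of infinite executions. -/

section InfiniteExecution

variable {n : ℕ} {K : Type*} [Field K] {o : MonomialOrder (Fin n)}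
  {f : ℕ → MvPolynomial (Fin n) K} {i m : ℕ} {e : ℕ → ℕ} {x y : State n K}
  {σ : ℕ → State n K}

/-- The execution is inside the call with index `i`. -/
def InCall (i : ℕ) : State n K → Prop
  | .head _ A => A.i = i
  | .spol _ A _ _ _ => A.i = i
  | .red _ A _ _ _ => A.i = i
  | .ins _ A _ _ => A.i = i
  | _ => False

lemma InCall.step (hx : InCall i x) (hs : Step o f x y) :
    InCall i y ∨ (∃ s G, y = .outer s i G) ∨ ∃ out, y = .halted out := by
  cases hs with
  | call => exact hx.elim
  | finish => exact hx.elim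
  | ret => obtain rfl := hx; exact Or.inr (Or.inl ⟨_, _, rfl⟩)
  | retOne => exact Or.inr (Or.inr ⟨_, rfl⟩)
  | _ => exact Or.inl hx

lemma AtHead.eq_of_inCall {i' : ℕ} (h : AtHead i' x) (hx : InCall i x) : i' = i := by
  obtain ⟨s, A, rfl, rfl⟩ := h
  exact hx

/-- Follow the given execution down the well-founded tree of all continuations. -/
lemma Inevitable.exists_ge {Q : State n K → Prop} (hσ : ∀ k, Step o f (σ k) (σ (k + 1)))
    (h : Inevitable o f Q x) : ∀ k, σ k = x → ∃ k' ≥ k, Q (σ k') := by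
  induction h with
  | now x hx => exact fun k hk => ⟨k, le_rfl, hk ▸ hx⟩
  | later x _ _ ih =>
    intro k hk
    obtain ⟨k', h1, h2⟩ := ih (σ (k + 1)) (hk ▸ hσ k) (k + 1) rfl
    exact ⟨k', (Nat.le_succ k).trans h1, h2⟩

/-- An infinite execution finally remains inside one call. -/
lemma exists_last_call (hσ : ∀ k, Step o f (σ k) (σ (k + 1))) :
    ∀ (i k : ℕ), (∃ s G, σ k = .outer s i G) →
      ∃ j k₀, (∃ s G, σ k₀ = .outer s (j + 1) G) ∧ AtHead j (σ (k₀ + 1)) ∧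
        ∀ k > k₀, InCall j (σ k) := by
  have hhalt : ∀ k out, σ k ≠ .halted out := fun k out h => by
    have := hσ k
    rw [h] at this
    cases this
  intro i
  induction i using Nat.strong_induction_on with
  | _ i ih =>
  rintro k ⟨s, G, hk⟩
  have hs := hσ k
  rw [hk] at hs
  generalize hy : σ (k + 1) = y at hs
  cases hs with
  | finish => exact (hhalt _ _ hy).elim
  | call _ j =>
  have hhead : AtHead j (σ (k + 1)) := by
    rw [hy]
    exact ⟨_, _, rfl, rfl⟩
  by_cases hall : ∀ k' > k, InCall j (σ k')
  · exact ⟨j, k, ⟨s, G, hk⟩, hhead, hall⟩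
  -- An infinite execution never halts, so a call can only be left by returning to the outer loop
  -- with the smaller index `j`, where the induction hypothesis applies.
  suffices ∃ k', ∃ s G, σ k' = .outer s j G by
    obtain ⟨k', h'⟩ := this
    exact ih j (Nat.lt_succ_self j) k' h'
  by_contra hno
  refine hall fun k' hk' => ?_
  induction k', hk' using Nat.le_induction with
  | base => rw [hy]; rfl
  | succ k' _ ih' =>
    rcases ih'.step (hσ k') with h | ⟨s', G', h⟩ | ⟨out, h⟩
    · exact h
    · exact (hno ⟨k' + 1, s', G', h⟩).elim
    · exact (hhalt _ _ h).elim

lemma startsIteration_of_step (hx : AtHead i x) (hs : Step o f x y) (hy : InCall i y) :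
    ∃ d, StartsIteration i x d := by
  obtain ⟨s, A, rfl, rfl⟩ := hx
  cases hs with
  | ret => exact hy.elim
  | retOne => exact hy.elim
  | iter _ _ d hd => exact ⟨d, s, A, rfl, rfl, hd⟩

lemma StartsIteration.inevitable {d : ℕ} (hI : Inv o e m x) (hx : StartsIteration i x d)
    (hs : Step o f x y) : Inevitable o f (AtHead i) y := by
  obtain ⟨s, A, rfl, rfl, hd⟩ := hx
  exact HeadInv.inevitable hI hd hs

lemma reflTransGen_of_forall_not_atHead (hσ : ∀ k, Step o f (σ k) (σ (k + 1))) {a b : ℕ}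
    (hab : a ≤ b) (h : ∀ k, a ≤ k → k < b → ∀ i', ¬ AtHead i' (σ k)) :
    Relation.ReflTransGen (fun x y => (∀ i', ¬ AtHead i' x) ∧ Step o f x y) (σ a) (σ b) := by
  induction b, hab using Nat.le_induction with
  | base => exact .refl
  | succ b hab ih =>
    exact (ih fun k h1 h2 => h k h1 (h2.trans (Nat.lt_succ_self b))).tail
      ⟨h b hab (Nat.lt_succ_self b), hσ b⟩

lemma tendsto_atTop_of_lt_add_two {d : ℕ → ℕ} (hd : ∀ j, d j < d (j + 2)) :
    Filter.Tendsto d Filter.atTop Filter.atTop := by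
  -- Each double step raises `d` by at least 1; the summand 1 covers the starting value j = 1.
  have h : ∀ j, j ≤ 2 * d j + 1 := by
    intro j
    induction j using Nat.twoStepInduction with
    | zero => omega
    | one => omega
    | more j ih _ =>
      have := hd j
      omega
  refine Filter.tendsto_atTop.mpr fun b => ?_
  filter_upwards [Filter.eventually_ge_atTop (2 * b + 1)] with j hj
  have := h j
  omega

/-- In an infinite execution, one call has infinitely many iterations. -/
lemma exists_infinite_call (hinv : ∀ k, Inv o e m (σ k))
    (hσ : ∀ k, Step o f (σ k) (σ (k + 1))) {s : Store n K} {G : Finset ℕ} {i₀ : ℕ}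
    (h0 : σ 0 = .outer s i₀ G) :
    ∃ (i k₀ : ℕ) (t d : ℕ → ℕ),
      (∃ s G, σ k₀ = .outer s (i + 1) G) ∧ t 0 = k₀ + 1 ∧ StrictMono t ∧
      (∀ j, StartsIteration i (σ (t j)) (d j)) ∧
      (∀ k, k₀ < k → (∃ i', AtHead i' (σ k)) → ∃ j, k = t j) ∧
      (∀ j, d j < d (j + 2)) ∧
      Filter.Tendsto d Filter.atTop Filter.atTop := by
  obtain ⟨i, k₀, hout, hhead, hcall⟩ := exists_last_call hσ i₀ 0 ⟨s, G, h0⟩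
  let H : ℕ → Prop := fun k => k₀ < k ∧ AtHead i (σ k)
  have hstart : ∀ k, H k → ∃ d, StartsIteration i (σ k) d := fun k hk =>
    startsIteration_of_step hk.2 (hσ k) (hcall _ (hk.1.trans (Nat.lt_succ_self k)))
  have hnext : ∀ k, H k → ∃ k' > k, H k' := fun k hk => by
    obtain ⟨d, hd⟩ := hstart k hk
    obtain ⟨k', h1, h2⟩ := (hd.inevitable (hinv k) (hσ k)).exists_ge hσ (k + 1) rfl
    exact ⟨k', h1, hk.1.trans h1, h2⟩
  -- Every visit to the loop test is followed by another, so `Nat.nth` enumerates the visits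
  -- increasingly.
  have hinf : (Set.ofPred H).Infinite := by
    refine Set.infinite_of_forall_exists_gt fun a => ?_
    induction a with
    | zero => exact ⟨k₀ + 1, ⟨Nat.lt_succ_self _, hhead⟩, Nat.succ_pos _⟩
    | succ a ih =>
      obtain ⟨b, hb, hab⟩ := ih
      obtain ⟨c, hc, hcH⟩ := hnext b hb
      exact ⟨c, hcH, lt_of_le_of_lt hab hc⟩
  have hmono := Nat.nth_strictMono hinf
  have hH : ∀ j, H (Nat.nth H j) := Nat.nth_mem_of_infinite hinf
  have hcover : ∀ k, k₀ < k → (∃ i', AtHead i' (σ k)) → ∃ j, k = Nat.nth H j := by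
    rintro k hk ⟨i', h⟩
    obtain rfl := h.eq_of_inCall (hcall k hk)
    obtain ⟨j, hj⟩ := Nat.subset_range_nth (show k ∈ Set.ofPred H from ⟨hk, h⟩)
    exact ⟨j, hj.symm⟩
  choose d hd using fun j => hstart _ (hH j)
  -- Between two consecutive visits there is no other loop test, so the steps between them form one
  -- iteration.
  have hiter : ∀ j, Iteration o f i (σ (Nat.nth H j)) (d j) (σ (Nat.nth H (j + 1))) := by
    intro j
    refine ⟨hd j, (hH _).2, _, hσ _, reflTransGen_of_forall_not_atHead hσ
      (hmono (Nat.lt_succ_self j)) fun k h1 h2 i' hi' => ?_⟩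
    obtain ⟨j', rfl⟩ := hcover k ((hH j).1.trans h1) ⟨i', hi'⟩
    have h3 := hmono.lt_iff_lt.mp h1
    have h4 := hmono.lt_iff_lt.mp h2
    omega
  have hlt : ∀ j, d j < d (j + 2) := fun j =>
    (hiter j).lt (hinv _) (hiter (j + 1)) (hd (j + 2))
  refine ⟨i, k₀, Nat.nth H, d, hout, ?_, hmono, hd, hcover, hlt, tendsto_atTop_of_lt_add_two hlt⟩
  obtain ⟨j, hj⟩ := hcover (k₀ + 1) (Nat.lt_succ_self _) ⟨i, hhead⟩
  exact le_antisymm (hj ▸ hmono.monotone (Nat.zero_le j)) (hH 0).1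

end InfiniteExecution

end F5

theorem mainTheorem9 {K : Type*} [Field K] {n : ℕ} (o : MonomialOrder (Fin n))
    (m : ℕ) (hm : 1 ≤ m) (f : ℕ → MvPolynomial (Fin n) K)
    (hf0 : ∀ i, 1 ≤ i → i ≤ m → f i ≠ 0)
    (hfhom : ∀ i, 1 ≤ i → i ≤ m → ∃ e : ℕ, (f i).IsHomogeneous e) :
    -- every iteration of the while cycle inside `AlgorithmF5` terminates
    (∀ (i : ℕ) (x : F5.State n K) (d : ℕ),
      F5.Reachable o m f x → F5.StartsIteration i x d →
        (∃ y, F5.Step o f x y) ∧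
        ∀ y, F5.Step o f x y → F5.Inevitable o f (F5.AtHead i) y) ∧
    -- every call to `Reduction` terminates
    (∀ (s : F5.Store n K) (A : F5.Frame n K) (d : ℕ) (F : Finset ℕ),
      F5.Reachable o m f (.red s A d F ∅) →
        F5.Inevitable o f (fun z => ∃ s' Rd, z = .ins s' A d Rd) (.red s A d F ∅)) ∧
    -- `d_{j+2} > d_j` for the iterations of one call to `AlgorithmF5`
    (∀ (i : ℕ) (x₀ x₁ x₂ : F5.State n K) (d₀ d₁ d₂ : ℕ),
      F5.Reachable o m f x₀ → F5.Iteration o f i x₀ d₀ x₁ → F5.Iteration o f i x₁ d₁ x₂ →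
        F5.StartsIteration i x₂ d₂ → d₀ < d₂) ∧
    -- if the algorithm does not terminate, then some call to `AlgorithmF5` has infinitely many
    -- iterations, and the value of `d` in its iterations tends to infinity
    (∀ σ : ℕ → F5.State n K, σ 0 = F5.start o m f → (∀ k, F5.Step o f (σ k) (σ (k + 1))) →
      ∃ (i k₀ : ℕ) (t d : ℕ → ℕ),
        (∃ s G, σ k₀ = .outer s (i + 1) G) ∧ t 0 = k₀ + 1 ∧ StrictMono t ∧
        (∀ j, F5.StartsIteration i (σ (t j)) (d j)) ∧
        (∀ k, k₀ < k → (∃ i', F5.AtHead i' (σ k)) → ∃ j, k = t j) ∧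
        (∀ j, d j < d (j + 2)) ∧
        Filter.Tendsto d Filter.atTop Filter.atTop) := by
  -- These degrees of the input polynomials grade the signatures throughout.
  choose! e he using hfhom
  have hinv : ∀ x, F5.Reachable o m f x → F5.Inv o e m x := fun x hx => hx.inv hm hf0 he
  refine ⟨fun i x d hx hd => ⟨?_, fun y hy => hd.inevitable (hinv x hx) hy⟩,
    fun s A d F hx => ?_, fun i x₀ x₁ x₂ d₀ d₁ d₂ hx h₀ h₁ h₂ => h₀.lt (hinv x₀ hx) h₁ h₂,
    fun σ h0 hσ => F5.exists_infinite_call (fun k => hinv _ ?_) hσ h0⟩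
  · obtain ⟨s, A, rfl, -, hd⟩ := hd
    exact ⟨_, .iter s A d hd⟩
  · obtain ⟨i, d', -, rfl, hI⟩ := hinv _ hx
    exact hI.inevitable
  · induction k with
    | zero => exact h0 ▸ .refl
    | succ k ih => exact ih.tail (hσ k)
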